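/- **Topological notions.** For a topological space $(X,\tau)$ let $d_\tau(A)$ be the set of limit points of $A\subseteq X$. The space is *scattered* if every nonempty subspace has an isolated point. For a scattered space put $d^0X=X$, $d^{\alpha+1}X=d_\tau(d^\alpha X)$, $d^\alpha X=\bigcap_{\beta<\alpha}d^\beta X$ for limit $\alpha$, and let $\rho_\tau(x)=\min\{\alpha: x\notin d^{\alpha+1}X\}$. A topology $\sigma\supseteq\tau$ on $X$ is an *$\ell$-extension* of $\tau$ if $\rho_\sigma=\rho_\tau$ and, for every $U\in\sigma$ and every $x\in U$ such that $\rho_\tau(x)$ is not a limit ordinal, there is $V\in\tau$ with $x\in V\subseteq U$. A topology is *$\ell$-maximal* if it has no proper $\ell$-extension. Let $\tau^+$ be the topology generated by $\tau\cup\{d_\tau(A):A\subseteq X\}$. A space $(X,\tau_0,\dots,\tau_n)$ is an *lme-space based on* a scattered topology $\tau$ if $\tau_0$ is an $\ell$-maximal $\ell$-extension of $\tau$ and, for each $i<n$, $\tau_{i+1}$ is an $\ell$-maximal $\ell$-extension of $\tau_i^+$. For an ordinal $\lambda$, $([1,\lambda],\tau_0,\dots,\tau_n)$ is an *ordinal lme-space*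 if it is an lme-space based on the order topology of the interval of ordinals $[1,\lambda]$. A *$\mathrm{GLP}_n$-space* is a space $(X,\tau_0,\dots,\tau_n)$ in which all $\tau_i$ are scattered and, for $i<n$, $\tau_i\subseteq\tau_{i+1}$ and $d_{\tau_i}(A)\in\tau_{i+1}$ for all $A\subseteq X$ (every lme-space is one). A *$d$-map* is a continuous open map all of whose fibres are discrete subspaces. **$J_n$-trees.** Let $T=(T,R_0,\dots,R_n)$ be a set with binary relations. It is a *$J_n$-frame* if each $R_k$ is transitive and dually well-founded and, for $m<k$: if $xR_ky$ then ($xR_mz$ iff $yR_mz$); and $xR_my$, $yR_kz$ imply $xR_mz$. Write $R_k^*=R_k\cup\dots\cup R_n$ (so $R^*_{n+1}=\emptyset$). A *$k$-sheet* is a class of the equivalence relation generated by $R_k^*$; for $(k+1)$-sheets $\alpha,\beta$ write $\alpha R_k\beta$ if $xR_ky$ for some $x\in\alpha$, $y\in\beta$. A finite $J_n$-frame $T$ is a *finite $J_n$-tree* if, for each $k\le n$, the $(k+1)$-sheets contained in any given $k$-sheet form a tree under $R_k$ (a strict partial order with a root below all other elements, in which the predecessors of each element are linearly ordered), and $\alpha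 R_k\beta$ implies $xR_ky$ for all $x\in\alpha$, $y\in\beta$. A point $w$ is a *hereditary $k$-root* if $vR_jw$ holds for no $v\in T$ and no $j\ge k$. **$J_n$-morphisms.** Let $\sigma_k$ be the topology on $T$ whose open sets are the $R_k$-upsets. A map $f:X\to T$ from a $\mathrm{GLP}_n$-space $X=(X,\tau_0,\dots,\tau_n)$ is a *$J_n$-morphism* if 1. $f:(X,\tau_n)\to(T,\sigma_n)$ is a $d$-map; 2. $f:(X,\tau_k)\to(T,\sigma_k)$ is open for all $k\le n$; 3. for each $k<n$ and each hereditary $(k+1)$-root $w$, the sets $f^{-1}(R_k^*(w))$ and $f^{-1}(R_k^*(w)\cup\{w\})$ are $\tau_k$-open; 4. for each $k<n$ and each hereditary $(k+1)$-root $w$, $f^{-1}(w)$ is a discrete subspace of $(X,\tau_k)$. **Lemma.** For each $n\geq 0$ and each finite $J_n$-tree $T$ there exist an ordinal $\lambda<\varepsilon_0$, an ordinal lme-space $X=([1,\lambda],\tau_0,\dots,\tau_n)$ and a surjective $J_n$-morphism $f:X\to T$. -/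

import Mathlib

open scoped Topology Ordinal

universe u v

namespace GLPSpaces

section Topology

variable {X : Type u} {Y : Type v}

/-- `(X, τ)` is scattered: every nonempty subspace has an isolated point. -/
def IsScattered (τ : TopologicalSpace X) : Prop :=
  ∀ A : Set X, A.Nonempty → ∃ x ∈ A, ∃ U : Set X, IsOpen[τ] U ∧ U ∩ A = {x}

/-- The `α`-th term `d^α X` of the Cantor–Bendixson sequence of the whole space `(X, τ)`.
(All terms are closed, so the relative derived set in Mathlib's definition is the derived set.) -/
def cbDeriv (τ : TopologicalSpace X) (α : Ordinal.{u}) : Set X :=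
  @CantorBendixson.iteratedDerivedSet X τ Set.univ α

/-- The rank function `ρ_τ(x) = min {α : x ∉ d^(α+1) X}`. -/
noncomputable def rank (τ : TopologicalSpace X) (x : X) : Ordinal.{u} :=
  sInf {α : Ordinal.{u} | x ∉ cbDeriv τ (α + 1)}

/-- `σ` is a rank preserving extension of `τ`; `σ ≤ τ` says that every `τ`-open set is
`σ`-open. -/
structure IsRankPreservingExtension (τ σ : TopologicalSpace X) : Prop where
  extends_base : σ ≤ τ
  rank_eq : ∀ x, rank σ x = rank τ x

/-- `σ` is an `ℓ`-extension of `τ`. -/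
structure IsLExtension (τ σ : TopologicalSpace X) : Prop
    extends IsRankPreservingExtension τ σ where
  nhds_of_not_limit : ∀ U : Set X, IsOpen[σ] U → ∀ x ∈ U, ¬ Order.IsSuccLimit (rank τ x) →
    ∃ V : Set X, IsOpen[τ] V ∧ x ∈ V ∧ V ⊆ U

/-- `(X, τ)` is `ℓ`-maximal: it has no proper `ℓ`-extension. -/
def IsLMaximal (τ : TopologicalSpace X) : Prop :=
  ∀ σ : TopologicalSpace X, IsLExtension τ σ → σ = τ

/-- `σ` is an `ℓ`-maximal `ℓ`-extension of `τ`. -/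
def IsLMaximalLExtension (τ σ : TopologicalSpace X) : Prop :=
  IsLExtension τ σ ∧ IsLMaximal σ

/-- The next topology `τ⁺`, generated by `τ` and all sets `d_τ(A)`. -/
@[reducible] def nextTopology (τ : TopologicalSpace X) : TopologicalSpace X :=
  TopologicalSpace.generateFrom
    ({U : Set X | IsOpen[τ] U} ∪ Set.range fun A : Set X => @derivedSet X τ A)

/-- `(X, τ₀, …, τₙ)` is a GLPₙ-space. -/
structure IsGLPSpace {n : ℕ} (τ : Fin (n + 1) → TopologicalSpace X) : Prop where
  scattered : ∀ k, IsScattered (τ k)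
  mono : ∀ k : Fin n, ∀ U : Set X, IsOpen[τ k.castSucc] U → IsOpen[τ k.succ] U
  derived_open : ∀ k : Fin n, ∀ A : Set X, IsOpen[τ k.succ] (@derivedSet X (τ k.castSucc) A)

/-- `(X, τ₀, …, τₙ)` is an lme-space based on the scattered topology `τ`. -/
structure IsLMESpace {n : ℕ} (base : TopologicalSpace X)
    (τ : Fin (n + 1) → TopologicalSpace X) : Prop where
  scattered_base : IsScattered base
  zero : IsLMaximalLExtension base (τ 0)
  succ : ∀ k : Fin n, IsLMaximalLExtension (nextTopology (τ k.castSucc)) (τ k.succ)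

/-- `([1, lam], τ₀, …, τₙ)` is an ordinal lme-space: it is based on the order topology. -/
def IsOrdinalLMESpace {n : ℕ} (lam : Ordinal.{u})
    (τ : Fin (n + 1) → TopologicalSpace (Set.Icc 1 lam)) : Prop :=
  IsLMESpace (Preorder.topology (Set.Icc 1 lam)) τ

/-- A `d`-map: continuous, open and pointwise discrete. -/
structure IsDMap (τ : TopologicalSpace X) (σ : TopologicalSpace Y) (f : X → Y) : Prop where
  continuous : Continuous[τ, σ] f
  isOpenMap : @IsOpenMap X Y τ σ f
  discrete_fiber : ∀ y, @IsDiscrete X τ (f ⁻¹' {y})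

end Topology

section Frames

variable {T : Type v} {n : ℕ}

/-- The union `R_k ∪ R_{k+1} ∪ … ∪ R_n`; on J-frames this relation is transitive. For `k = n + 1`
it is empty. -/
def RStar (R : Fin (n + 1) → T → T → Prop) (k : ℕ) (x y : T) : Prop :=
  ∃ i : Fin (n + 1), k ≤ (i : ℕ) ∧ R i x y

/-- `S` is a `k`-sheet: a class of the equivalence relation generated by
`R_k ∪ R_{k+1} ∪ … ∪ R_n`. -/
def IsSheet (R : Fin (n + 1) → T → T → Prop) (k : ℕ) (S : Set T) : Prop :=
  ∃ x, S = {y | Relation.EqvGen (RStar R k) x y}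

/-- The relation induced by `R_k` on sets of points: some point of `A` is `R_k`-related to some
point of `B`. -/
def SheetRel (R : Fin (n + 1) → T → T → Prop) (k : Fin (n + 1)) (A B : Set T) : Prop :=
  ∃ x ∈ A, ∃ y ∈ B, R k x y

/-- `P` is a (finite) tree under the strict order `lt`: there is a root below everything else,
and the predecessors of each element are linearly ordered. -/
structure IsTreeUnder {α : Type v} (P : Set α) (lt : α → α → Prop) : Prop where
  irrefl : ∀ a ∈ P, ¬ lt a a
  trans : ∀ a ∈ P, ∀ b ∈ P, ∀ c ∈ P, lt a b → lt b c → lt a c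
  root : ∃ r ∈ P, ∀ a ∈ P, a = r ∨ lt r a
  linear : ∀ a ∈ P, ∀ b ∈ P, ∀ c ∈ P, lt a c → lt b c → lt a b ∨ a = b ∨ lt b a

/-- `(T, R_0, …, R_n)` is a `J_n`-frame. -/
structure IsJFrame (R : Fin (n + 1) → T → T → Prop) : Prop where
  trans : ∀ k x y z, R k x y → R k y z → R k x z
  dually_wf : ∀ k, WellFounded (Function.swap (R k))
  stable : ∀ m k, m < k → ∀ x y z, R k x y → (R m x z ↔ R m y z)
  absorb : ∀ m k, m < k → ∀ x y z, R m x y → R k y z → R m x z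

/-- `(T, R_0, …, R_n)` is a tree-like `J_n`-frame, or `J_n`-tree: for each `k`, the
`(k+1)`-sheets contained in a `k`-sheet form a tree under `R_k`, and if two `(k+1)`-sheets are
`R_k`-related, then all their points are. -/
structure IsJTree (R : Fin (n + 1) → T → T → Prop) : Prop extends IsJFrame R where
  tree : ∀ (k : Fin (n + 1)) (S : Set T), IsSheet R (k : ℕ) S →
    IsTreeUnder {A : Set T | IsSheet R ((k : ℕ) + 1) A ∧ A ⊆ S} (SheetRel R k)
  uniform : ∀ (k : Fin (n + 1)) (A B : Set T), IsSheet R ((k : ℕ) + 1) A → IsSheet R ((k : ℕ) + 1) B →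
    SheetRel R k A B → ∀ x ∈ A, ∀ y ∈ B, R k x y

/-- `w` is a hereditary `k`-root. -/
def IsHereditaryRoot (R : Fin (n + 1) → T → T → Prop) (k : ℕ) (w : T) : Prop :=
  ∀ j : Fin (n + 1), k ≤ (j : ℕ) → ∀ v, ¬ R j v w

/-- The topology whose open sets are the upsets of a binary relation. -/
@[reducible] def upsetTopology (r : T → T → Prop) : TopologicalSpace T where
  IsOpen U := ∀ x ∈ U, ∀ y, r x y → y ∈ U
  isOpen_univ := fun _ _ _ _ => trivial
  isOpen_inter := fun _ _ hU hV x hx y hxy => ⟨hU x hx.1 y hxy, hV x hx.2 y hxy⟩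
  isOpen_sUnion := fun _ h x ⟨U, hU, hx⟩ y hxy => ⟨U, hU, h U hU x hx y hxy⟩

/-- `f` is a `J_n`-morphism from the GLPₙ-space `(X, τ₀, …, τₙ)` to `(T, R_0, …, R_n)`. -/
structure IsJMorphism {X : Type u} (τ : Fin (n + 1) → TopologicalSpace X)
    (R : Fin (n + 1) → T → T → Prop) (f : X → T) : Prop where
  glp : IsGLPSpace τ
  j1 : IsDMap (τ (Fin.last n)) (upsetTopology (R (Fin.last n))) f
  j2 : ∀ k, @IsOpenMap X T (τ k) (upsetTopology (R k)) f
  j3 : ∀ k : Fin n, ∀ w, IsHereditaryRoot R ((k : ℕ) + 1) w →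
    IsOpen[τ k.castSucc] (f ⁻¹' {v | RStar R (k : ℕ) w v}) ∧
    IsOpen[τ k.castSucc] (f ⁻¹' ({v | RStar R (k : ℕ) w v} ∪ {w}))
  j4 : ∀ k : Fin n, ∀ w, IsHereditaryRoot R ((k : ℕ) + 1) w →
    @IsDiscrete X (τ k.castSucc) (f ⁻¹' {w})

end Frames

end GLPSpaces

/-! ### Cantor–Bendixson ranks, d-maps and existence of ℓ-maximal ℓ-extensions. -/

namespace GLPSpaces

variable {X : Type u} {Y : Type v}

/-! The tree is realised sheet by sheet, by downward induction on the level `k`, with one extra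
invariant (`Realizes`): a hereditary root is taken only at the last point of the interval. Beyond
level `n` sheets are single points, realised on `[1, 1]`. Inside level `k`, an `R k`-closed union of
`(k+1)`-sheets is handled by induction on its size (`realizes_of_sheets`): either it splits into two
closed parts, whose realisations are put side by side on an ordinal sum (`Realizes.union`), or it is
one lowest sheet together with its `R k`-successors, and a cone is built (`Realizes.cone`).

For the cone, let `[1, μ]` realise the successors at level `k` and `[1, κ]` the lowest sheet at
level `k + 1`. If `μ ≠ 0`, let `C` be the set of multiples of `μ * ω` in `[1, μ * ω * ω ^ (κ - 1)]`.
Off `C` the interval is a union of open copies of `[1, μ]`, and copies accumulate at every point of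
`C`. The rank at a point of `C` is `η + e`, where `η` is the strict supremum of the ranks of `[1,
μ]` and `e` is the last Cantor exponent after division by `μ * ω`. If `τ₀` is an ℓ-maximal
ℓ-extension, then `C` is open in `τ₀⁺` and `1 + e` is a d-map from `C` onto `[1, κ]` with the order
topology (`isDMap_rank_next`). Thus the topologies of the lowest sheet appear one level higher,
which is where its relations start.

It remains to choose topologies on the interval that make the folding map off `C` and the rank map
on `C` d-maps at all levels. This is `exists_isLMESeq_lift`. Its engine is
`IsLMaximal.isOpen_insert`: an ℓ-maximal topology already contains every enlargement of an open set
by a limit-rank point that maximality could forbid. Hence d-maps onto ℓ-maximal spaces survive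
ℓ-extensions of the domain (`IsDMap.of_isLExtension`), and the next topology depends only on the
topology and the rank (`IsLMaximal.isOpen_next_iff`), so d-maps pass to next topologies
(`IsDMap.next`). -/

lemma mem_derivedSet_iff_open {τ : TopologicalSpace X} {A : Set X} {x : X} :
    x ∈ @derivedSet X τ A ↔ ∀ U, IsOpen[τ] U → x ∈ U → ∃ y ∈ U, y ∈ A ∧ y ≠ x := by
  rw [mem_derivedSet, accPt_iff_nhds]
  constructor
  · intro h U hU hx
    obtain ⟨y, hy, hne⟩ := h U (hU.mem_nhds hx)
    exact ⟨y, hy.1, hy.2, hne⟩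
  · intro h U hU
    obtain ⟨V, hVU, hV, hx⟩ := mem_nhds_iff.1 hU
    obtain ⟨y, hy, hA, hne⟩ := h V hV hx
    exact ⟨y, ⟨hVU hy, hA⟩, hne⟩

lemma isOpen_of_local {τ : TopologicalSpace X} {U : Set X}
    (h : ∀ x ∈ U, ∃ V, IsOpen[τ] V ∧ x ∈ V ∧ V ⊆ U) : IsOpen[τ] U := by
  refine isOpen_iff_mem_nhds.2 fun x hx => ?_
  obtain ⟨V, hV, hxV, hVU⟩ := h x hx
  exact Filter.mem_of_superset (hV.mem_nhds hxV) hVU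

lemma isOpen_inter_of {τ : TopologicalSpace X} {U V : Set X} (hU : IsOpen[τ] U)
    (hV : IsOpen[τ] V) : IsOpen[τ] (U ∩ V) := hU.inter hV

lemma isOpen_induced_preimage {τ : TopologicalSpace Y} {i : X → Y} {V : Set Y}
    (hV : IsOpen[τ] V) : IsOpen[TopologicalSpace.induced i τ] (i ⁻¹' V) := ⟨V, hV, rfl⟩

lemma isDiscrete_iff_isolated {τ : TopologicalSpace X} {s : Set X} :
    @IsDiscrete X τ s ↔ ∀ x ∈ s, ∃ U, IsOpen[τ] U ∧ x ∈ U ∧ ∀ y ∈ U, y ∈ s → y = x := by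
  rw [isDiscrete_iff_forall_mem_exists_isOpen]
  refine forall₂_congr fun x hx => exists_congr fun U => and_congr_right fun _ => ?_
  constructor
  · intro h
    refine ⟨?_, fun y hy hys => ?_⟩
    · have : x ∈ U ∩ s := h ▸ rfl
      exact this.1
    · have : y ∈ U ∩ s := ⟨hy, hys⟩
      rw [h] at this
      exact this
  · rintro ⟨h1, h2⟩
    ext y
    exact ⟨fun h => h2 y h.1 h.2, fun h => by rw [Set.mem_singleton_iff.1 h]; exact ⟨h1, hx⟩⟩

/-- `h` behaves as the Cantor–Bendixson rank of `τ`: locally, `h` is strictly maximal at every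
point, and takes all smaller values in every neighbourhood. -/
structure IsRankFn (τ : TopologicalSpace X) (h : X → Ordinal.{u}) : Prop where
  lt : ∀ x, ∃ U, IsOpen[τ] U ∧ x ∈ U ∧ ∀ y ∈ U, y ≠ x → h y < h x
  hit : ∀ x U, IsOpen[τ] U → x ∈ U → ∀ β < h x, ∃ y ∈ U, h y = β

namespace IsRankFn

variable {τ : TopologicalSpace X} {h : X → Ordinal.{u}}

lemma mem_derivedSet_iff (H : IsRankFn τ h) {α : Ordinal.{u}} {x : X} :
    x ∈ @derivedSet X τ {y | α ≤ h y} ↔ α < h x := by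
  rw [mem_derivedSet_iff_open]
  constructor
  · intro hx
    obtain ⟨U, hU, hxU, hlt⟩ := H.lt x
    obtain ⟨y, hy, hα, hne⟩ := hx U hU hxU
    exact lt_of_le_of_lt hα (hlt y hy hne)
  · intro hα U hU hx
    obtain ⟨y, hy, rfl⟩ := H.hit x U hU hx α hα
    exact ⟨y, hy, le_refl (h y), fun e => by simp [e] at hα⟩

lemma mem_cbDeriv_iff (H : IsRankFn τ h) (α : Ordinal.{u}) (x : X) :
    x ∈ cbDeriv τ α ↔ α ≤ h x := by
  unfold cbDeriv
  induction α using Ordinal.limitRecOn generalizing x with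
  | zero => simp
  | add_one α ih =>
    rw [CantorBendixson.iteratedDerivedSet_succ, relDerivedSet_apply]
    have : @CantorBendixson.iteratedDerivedSet X τ Set.univ α = {y | α ≤ h y} := by
      ext y; exact ih y
    rw [this, Set.mem_inter_iff, H.mem_derivedSet_iff, Order.add_one_le_iff]
    exact ⟨fun h => h.1, fun h => ⟨h, h.le⟩⟩
  | limit α hα ih =>
    rw [CantorBendixson.iteratedDerivedSet_limit hα]
    simp only [Set.mem_iInter, Subtype.forall, Set.mem_Iio]
    constructor
    · intro hx
      by_contra! hlt
      have := (ih _ (hα.succ_lt hlt) x).1 (hx _ (hα.succ_lt hlt))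
      exact absurd this (by simp)
    · intro hx b hb
      exact (ih b hb x).2 (hb.le.trans hx)

/-- The two local conditions force the derived sets to be the superlevel sets of `h`. Ranks can
therefore be exhibited and transported without iterating derivatives. -/
lemma rank_eq (H : IsRankFn τ h) : rank τ = h := by
  funext x
  have : {α : Ordinal.{u} | x ∉ cbDeriv τ (α + 1)} = Set.Ici (h x) := by
    ext α
    simp [H.mem_cbDeriv_iff]
  rw [rank, this, csInf_Ici]

lemma isScattered (H : IsRankFn τ h) : IsScattered τ := by
  intro A hA
  obtain ⟨x, hx, hmin⟩ := (InvImage.wf h Ordinal.lt_wf).has_min A hA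
  obtain ⟨U, hU, hxU, hlt⟩ := H.lt x
  refine ⟨x, hx, U, hU, ?_⟩
  ext y
  refine ⟨fun hy => ?_, fun hy => by rw [Set.mem_singleton_iff.1 hy]; exact ⟨hxU, hx⟩⟩
  by_contra hne
  exact hmin y hy.2 (hlt y hy.1 hne)

lemma isOpen_lt (H : IsRankFn τ h) (α : Ordinal.{u}) : IsOpen[τ] {y | h y < α} := by
  refine isOpen_of_local fun x hx => ?_
  obtain ⟨U, hU, hxU, hlt⟩ := H.lt x
  refine ⟨U, hU, hxU, fun y hy => ?_⟩
  by_cases e : y = x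
  · exact e ▸ hx
  · exact (hlt y hy e).trans hx

lemma isolated (H : IsRankFn τ h) (x : X) :
    ∃ U, IsOpen[τ] U ∧ x ∈ U ∧ ∀ y ∈ U, h x ≤ h y → y = x := by
  obtain ⟨U, hU, hxU, hlt⟩ := H.lt x
  exact ⟨U, hU, hxU, fun y hy hle => by_contra fun e => (hlt y hy e).not_ge hle⟩

end IsRankFn

/-- The perfect kernel has no isolated point, so it is empty in a scattered space and every point is
eventually removed. The stage of removal is the rank. -/
lemma IsScattered.isRankFn {τ : TopologicalSpace X} (hs : IsScattered τ) :
    IsRankFn τ (rank τ) := by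
  have hP : CantorBendixson.perfectKernel (Set.univ : Set X) = ∅ := by
    by_contra hne
    obtain ⟨x, hx, U, hU, hUx⟩ := hs _ (Set.nonempty_iff_ne_empty.2 hne)
    have hacc := (CantorBendixson.perfect_perfectKernel (X := X) isClosed_univ).acc x hx
    have hxU : x ∈ U ∩ CantorBendixson.perfectKernel Set.univ := by rw [hUx]; rfl
    obtain ⟨y, hy, hyne⟩ := accPt_iff_nhds.1 hacc U (hU.mem_nhds hxU.1)
    rw [hUx] at hy
    exact hyne hy
  have hanti : Antitone (cbDeriv τ) := CantorBendixson.iteratedDerivedSet_antitone Set.univ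
  have hex : ∀ x, ∃ α, x ∉ cbDeriv τ (α + 1) := by
    intro x
    have : x ∉ CantorBendixson.perfectKernel (Set.univ : Set X) := by simp [hP]
    rw [CantorBendixson.perfectKernel, Set.mem_iInter, not_forall] at this
    obtain ⟨α, hα⟩ := this
    exact ⟨α, fun h => hα (hanti (by simp) h)⟩
  have hnot : ∀ x, x ∉ cbDeriv τ (rank τ x + 1) := fun x => csInf_mem (hex x)
  have hmem : ∀ α x, x ∈ cbDeriv τ α ↔ α ≤ rank τ x := by
    intro α x
    constructor
    · intro h
      by_contra! hlt
      exact hnot x (hanti (Order.add_one_le_of_lt hlt) h)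
    · intro h
      refine hanti h ?_
      rcases Ordinal.zero_or_succ_or_isSuccLimit (rank τ x) with h0 | ⟨β, hβ⟩ | hl
      · rw [h0]; simp [cbDeriv]
      · rw [← hβ]
        by_contra hx
        have : rank τ x ≤ β := csInf_le' hx
        rw [← hβ] at this
        exact absurd this (by simp)
      · rw [cbDeriv, CantorBendixson.iteratedDerivedSet_limit hl]
        simp only [Set.mem_iInter, Subtype.forall, Set.mem_Iio]
        intro β hβ
        by_contra hx
        have : rank τ x ≤ β := csInf_le' (fun h' => hx (hanti (by simp) h'))
        exact hβ.not_ge this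
  have hsucc : ∀ α x, x ∈ cbDeriv τ (α + 1) ↔ x ∈ @derivedSet X τ (cbDeriv τ α) := by
    intro α x
    have hc : IsClosed (cbDeriv τ α) :=
      CantorBendixson.isClosed_iteratedDerivedSet isClosed_univ α
    rw [← hc.relDerivedSet_eq, cbDeriv, CantorBendixson.iteratedDerivedSet_succ]
    rfl
  refine ⟨fun x => ?_, fun x U hU hx β hβ => ?_⟩
  · have h1 := hnot x
    rw [hsucc, mem_derivedSet_iff_open] at h1
    push Not at h1
    obtain ⟨U, hU, hx, hlt⟩ := h1
    refine ⟨U, hU, hx, fun y hy hne => ?_⟩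
    by_contra! hle
    exact hne (hlt y hy ((hmem _ _).2 hle))
  -- Inside `U` there is a point of rank at least `β` and below that of `x`; descending in rank ends
  -- exactly at `β`.
  · induction hr : rank τ x using WellFoundedLT.induction generalizing x with
    | _ γ ih =>
      subst hr
      have h1 := (hmem (β + 1) x).2 (Order.add_one_le_of_lt hβ)
      rw [hsucc, mem_derivedSet_iff_open] at h1
      have h2 := hnot x
      rw [hsucc, mem_derivedSet_iff_open] at h2
      push Not at h2
      obtain ⟨V, hV, hxV, hlt⟩ := h2
      obtain ⟨y, hy, hyβ, hne⟩ := h1 (U ∩ V) (hU.inter hV) ⟨hx, hxV⟩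
      rw [hmem] at hyβ
      have hyx : rank τ y < rank τ x := by
        by_contra! hle
        exact hne (hlt y hy.2 ((hmem _ _).2 hle))
      rcases hyβ.eq_or_lt with e | hl
      · exact ⟨y, hy.1, e.symm⟩
      · exact ih _ hyx y hy.1 hl rfl

lemma isDMap_iff {τ : TopologicalSpace X} {σ : TopologicalSpace Y} {f : X → Y} :
    IsDMap τ σ f ↔ (∀ V, IsOpen[σ] V → IsOpen[τ] (f ⁻¹' V)) ∧
      (∀ U, IsOpen[τ] U → IsOpen[σ] (f '' U)) ∧
      ∀ x, ∃ U, IsOpen[τ] U ∧ x ∈ U ∧ ∀ y ∈ U, f y = f x → y = x := by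
  constructor
  · rintro ⟨h1, h2, h3⟩
    refine ⟨fun V hV => continuous_def.1 h1 V hV, h2, fun x => ?_⟩
    obtain ⟨U, hU, hx, h⟩ := isDiscrete_iff_isolated.1 (h3 (f x)) x rfl
    exact ⟨U, hU, hx, h⟩
  · rintro ⟨h1, h2, h3⟩
    refine ⟨continuous_def.2 h1, h2, fun y => isDiscrete_iff_isolated.2 ?_⟩
    rintro x rfl
    exact h3 x

/-- d-maps preserve rank: continuity and discrete fibres give local strict maximality, openness
gives the smaller values. -/
lemma IsRankFn.comp_isDMap {X Y : Type u} {τ : TopologicalSpace X} {σ : TopologicalSpace Y}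
    {h : Y → Ordinal.{u}} (H : IsRankFn σ h) {f : X → Y} (hf : IsDMap τ σ f) :
    IsRankFn τ (h ∘ f) := by
  obtain ⟨h1, h2, h3⟩ := isDMap_iff.1 hf
  refine ⟨fun x => ?_, fun x U hU hx β hβ => ?_⟩
  · obtain ⟨V, hV, hxV, hlt⟩ := H.lt (f x)
    obtain ⟨U, hU, hxU, hinj⟩ := h3 x
    exact ⟨U ∩ f ⁻¹' V, hU.inter (h1 V hV), ⟨hxU, hxV⟩,
      fun y hy hne => hlt _ hy.2 fun e => hne (hinj y hy.1 e)⟩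
  · obtain ⟨_, ⟨y, hy, rfl⟩, e⟩ := H.hit (f x) _ (h2 U hU) ⟨x, hx, rfl⟩ β hβ
    exact ⟨y, hy, e⟩

lemma IsScattered.mono {τ σ : TopologicalSpace X} (hs : IsScattered τ) (h : σ ≤ τ) :
    IsScattered σ := by
  intro A hA
  obtain ⟨x, hx, U, hU, e⟩ := hs A hA
  exact ⟨x, hx, U, h U hU, e⟩

/-- A criterion for `ℓ`-extensions in terms of a rank function of the smaller topology. -/
lemma IsRankFn.isLExtension {τ σ : TopologicalSpace X} {h : X → Ordinal.{u}} (H : IsRankFn τ h)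
    (hle : σ ≤ τ) (hit : ∀ x U, IsOpen[σ] U → x ∈ U → ∀ β < h x, ∃ y ∈ U, h y = β)
    (hn : ∀ U, IsOpen[σ] U → ∀ x ∈ U, ¬ Order.IsSuccLimit (h x) →
      ∃ V, IsOpen[τ] V ∧ x ∈ V ∧ V ⊆ U) : IsLExtension τ σ := by
  have H' : IsRankFn σ h := ⟨fun x => by
    obtain ⟨U, hU, r⟩ := H.lt x
    exact ⟨U, hle U hU, r⟩, hit⟩
  refine ⟨⟨hle, fun x => by rw [H.rank_eq, H'.rank_eq]⟩, ?_⟩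
  rwa [H.rank_eq]

lemma IsLExtension.isRankFn {τ σ : TopologicalSpace X} {h : X → Ordinal.{u}}
    (H : IsRankFn τ h) (hσ : IsLExtension τ σ) : IsRankFn σ h := by
  have := (H.isScattered.mono hσ.extends_base).isRankFn
  have e : rank σ = h := by rw [← H.rank_eq]; exact funext hσ.rank_eq
  rwa [e] at this

lemma IsLExtension.refl (τ : TopologicalSpace X) : IsLExtension τ τ :=
  ⟨⟨le_rfl, fun _ => rfl⟩, fun U hU _ hx _ => ⟨U, hU, hx, subset_rfl⟩⟩

lemma IsLExtension.trans {τ σ υ : TopologicalSpace X} (h : IsLExtension τ σ)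
    (h' : IsLExtension σ υ) : IsLExtension τ υ := by
  refine ⟨⟨h'.extends_base.trans h.extends_base, fun x => (h'.rank_eq x).trans (h.rank_eq x)⟩,
    fun U hU x hx hl => ?_⟩
  obtain ⟨V, hV, hxV, hVU⟩ := h'.nhds_of_not_limit U hU x hx (by rwa [h.rank_eq])
  obtain ⟨W, hW, hxW, hWV⟩ := h.nhds_of_not_limit V hV x hxV hl
  exact ⟨W, hW, hxW, hWV.trans hVU⟩

/-- Along a chain the neighbourhood filters are directed, so a neighbourhood for the common
refinement is already one for a member of the chain. -/
lemma isOpen_sInf_chain {c : Set (TopologicalSpace X)} (hc : IsChain (· ≤ ·) c)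
    (hne : c.Nonempty) {U : Set X} (hU : IsOpen[sInf c] U) {x : X} (hx : x ∈ U) :
    ∃ σ ∈ c, ∃ V, IsOpen[σ] V ∧ x ∈ V ∧ V ⊆ U := by
  have h1 : U ∈ @nhds X (sInf c) x := @IsOpen.mem_nhds X (sInf c) _ _ hU hx
  rw [nhds_sInf] at h1
  have hd : DirectedOn ((fun t => @nhds X t x) ⁻¹'o (· ≥ ·)) c := by
    intro a ha b hb
    rcases hc.total ha hb with hab | hab
    · exact ⟨a, ha, le_rfl, nhds_mono hab⟩
    · exact ⟨b, hb, nhds_mono hab, le_rfl⟩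
  obtain ⟨σ, hσ, h⟩ := (Filter.mem_biInf_of_directed hd hne).1 h1
  obtain ⟨V, hVU, hV, hxV⟩ := mem_nhds_iff.1 h
  exact ⟨σ, hσ, V, hV, hxV, hVU⟩

/-- Zorn's lemma, on the order dual since finer topologies are smaller. Being an ℓ-extension is
tested on neighbourhoods of one point, so it passes to the refinement generated by a chain. -/
theorem IsScattered.exists_isLMaximalLExtension {τ : TopologicalSpace X} (hs : IsScattered τ) :
    ∃ σ, IsLMaximalLExtension τ σ := by
  have H := hs.isRankFn
  obtain ⟨m, hm⟩ := zorn_le₀ (α := (TopologicalSpace X)ᵒᵈ) {σ | IsLExtension τ σ.ofDual} (by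
    intro c hcs hc
    rcases c.eq_empty_or_nonempty with rfl | hne
    · exact ⟨OrderDual.toDual τ, IsLExtension.refl τ, by simp⟩
    · let d : Set (TopologicalSpace X) := OrderDual.toDual ⁻¹' c
      have hd : IsChain (· ≤ ·) d := fun a ha b hb hab => (hc ha hb hab).symm
      have hdne : d.Nonempty := hne
      refine ⟨OrderDual.toDual (sInf d), ?_, fun z hz => ?_⟩
      · obtain ⟨σ₀, hσ₀⟩ := hdne
        refine H.isLExtension ((sInf_le hσ₀).trans (hcs hσ₀).extends_base) ?_ ?_
        · intro x U hU hx β hβ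
          obtain ⟨σ, hσ, V, hV, hxV, hVU⟩ := isOpen_sInf_chain hd ⟨σ₀, hσ₀⟩ hU hx
          obtain ⟨y, hy, e⟩ := (IsLExtension.isRankFn H (hcs hσ)).hit x V hV hxV β hβ
          exact ⟨y, hVU hy, e⟩
        · intro U hU x hx hl
          obtain ⟨σ, hσ, V, hV, hxV, hVU⟩ := isOpen_sInf_chain hd ⟨σ₀, hσ₀⟩ hU hx
          obtain ⟨W, hW, hxW, hWV⟩ := (hcs hσ).nhds_of_not_limit V hV x hxV hl
          exact ⟨W, hW, hxW, hWV.trans hVU⟩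
      · exact sInf_le (α := TopologicalSpace X) hz)
  refine ⟨m.ofDual, hm.prop, fun σ hσ => ?_⟩
  have h1 : IsLExtension τ σ := IsLExtension.trans hm.prop hσ
  exact le_antisymm hσ.extends_base (hm.2 (y := OrderDual.toDual σ) h1 hσ.extends_base)

end GLPSpaces

namespace GLPSpaces

variable {X Y Z O : Type u}

/-! ### `ℓ`-maximal topologies -/

/-- Declaring the traces on `V` of the neighbourhoods of `x`, with `x` added, to be neighbourhoods
of `x` changes nothing elsewhere. Unboundedness of the ranks on these traces keeps the rank of `x`,
which is a limit, so the result is an ℓ-extension and maximality makes it equal to `τ`. -/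
lemma IsLMaximal.isOpen_insert {τ : TopologicalSpace X} {h : X → Ordinal.{u}} (hm : IsLMaximal τ)
    (H : IsRankFn τ h) {x : X} (hx : Order.IsSuccLimit (h x)) {V : Set X} (hV : IsOpen[τ] V)
    (hun : ∀ N, IsOpen[τ] N → x ∈ N → ∀ β < h x, ∃ y ∈ N, y ∈ V ∧ β ≤ h y) :
    IsOpen[τ] (insert x V) := by
  let σ : TopologicalSpace X :=
    { IsOpen := fun U => (∀ y ∈ U, y ≠ x → ∃ W, IsOpen[τ] W ∧ y ∈ W ∧ W ⊆ U) ∧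
        (x ∈ U → ∃ N, IsOpen[τ] N ∧ x ∈ N ∧ N ∩ V ⊆ U)
      isOpen_univ := ⟨fun y _ _ => ⟨Set.univ, isOpen_univ, trivial, subset_rfl⟩,
        fun _ => ⟨Set.univ, isOpen_univ, trivial, Set.subset_univ _⟩⟩
      isOpen_inter := by
        rintro U U' ⟨h1, h2⟩ ⟨h1', h2'⟩
        refine ⟨fun y hy hne => ?_, fun hxU => ?_⟩
        · obtain ⟨W, hW, hyW, hWU⟩ := h1 y hy.1 hne
          obtain ⟨W', hW', hyW', hWU'⟩ := h1' y hy.2 hne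
          exact ⟨W ∩ W', hW.inter hW', ⟨hyW, hyW'⟩, Set.inter_subset_inter hWU hWU'⟩
        · obtain ⟨N, hN, hxN, hNU⟩ := h2 hxU.1
          obtain ⟨N', hN', hxN', hNU'⟩ := h2' hxU.2
          exact ⟨N ∩ N', hN.inter hN', ⟨hxN, hxN'⟩,
            fun z hz => ⟨hNU ⟨hz.1.1, hz.2⟩, hNU' ⟨hz.1.2, hz.2⟩⟩⟩
      isOpen_sUnion := by
        intro S hS
        refine ⟨?_, ?_⟩
        · rintro y ⟨U, hU, hy⟩ hne
          obtain ⟨W, hW, hyW, hWU⟩ := (hS U hU).1 y hy hne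
          exact ⟨W, hW, hyW, hWU.trans (Set.subset_sUnion_of_mem hU)⟩
        · rintro ⟨U, hU, hy⟩
          obtain ⟨W, hW, hyW, hWU⟩ := (hS U hU).2 hy
          exact ⟨W, hW, hyW, hWU.trans (Set.subset_sUnion_of_mem hU)⟩ }
  have hσ : IsLExtension τ σ := by
    refine H.isLExtension (fun U hU => ⟨fun y hy _ => ⟨U, hU, hy, subset_rfl⟩,
      fun hxU => ⟨U, hU, hxU, Set.inter_subset_left⟩⟩) ?_ ?_
    · intro y U hU hy β hβ
      by_cases e : y = x
      · subst e
        obtain ⟨N, hN, hxN, hNU⟩ := hU.2 hy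
        obtain ⟨z, hz, hzV, hle⟩ := hun N hN hxN β hβ
        rcases hle.eq_or_lt with e | hlt
        · exact ⟨z, hNU ⟨hz, hzV⟩, e.symm⟩
        · obtain ⟨w, hw, e⟩ := H.hit z (N ∩ V) (isOpen_inter_of hN hV) ⟨hz, hzV⟩ β hlt
          exact ⟨w, hNU hw, e⟩
      · obtain ⟨W, hW, hyW, hWU⟩ := hU.1 y hy e
        obtain ⟨w, hw, e⟩ := H.hit y W hW hyW β hβ
        exact ⟨w, hWU hw, e⟩
    · intro U hU y hy hl
      exact hU.1 y hy fun e => hl (e ▸ hx)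
  have hopen : IsOpen[σ] (insert x V) :=
    ⟨fun y hy hne => ⟨V, hV, hy.resolve_left hne, Set.subset_insert _ _⟩,
      fun _ => ⟨Set.univ, @isOpen_univ X τ, trivial, fun z hz => Or.inr hz.2⟩⟩
  rwa [hm σ hσ] at hopen

lemma IsRankFn.isOpen_next_gt {τ : TopologicalSpace X} {h : X → Ordinal.{u}} (H : IsRankFn τ h)
    (a : Ordinal.{u}) : IsOpen[nextTopology τ] {y | a < h y} := by
  refine TopologicalSpace.isOpen_generateFrom_of_mem (Or.inr ⟨{y | a ≤ h y}, ?_⟩)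
  ext y
  exact H.mem_derivedSet_iff

lemma nextTopology_le (τ : TopologicalSpace X) : nextTopology τ ≤ τ :=
  fun _ hU => TopologicalSpace.isOpen_generateFrom_of_mem (Or.inl hU)

lemma isOpen_next_derivedSet (τ : TopologicalSpace X) (A : Set X) :
    IsOpen[nextTopology τ] (@derivedSet X τ A) :=
  TopologicalSpace.isOpen_generateFrom_of_mem (Or.inr ⟨A, rfl⟩)

/-- Near a point of a derived set, that set contains every point of sufficiently large rank. At
successor rank only `x` itself has large rank. At limit rank the complement of the closure of `A`
cannot be enlarged by `x`, so by `IsLMaximal.isOpen_insert` its ranks are bounded near `x`. -/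
lemma IsLMaximal.derivedSet_nhds {τ : TopologicalSpace X} {h : X → Ordinal.{u}}
    (hm : IsLMaximal τ) (H : IsRankFn τ h) {A : Set X} {x : X} (hx : x ∈ @derivedSet X τ A) :
    ∃ N, IsOpen[τ] N ∧ x ∈ N ∧ ∃ a < h x, ∀ y ∈ N, a < h y → y ∈ @derivedSet X τ A := by
  obtain ⟨U, hU, hxU, hlt⟩ := H.lt x
  have hxA := mem_derivedSet_iff_open.1 hx
  rcases Ordinal.zero_or_succ_or_isSuccLimit (h x) with h0 | ⟨b, hb⟩ | hl
  · obtain ⟨y, hy, -, hne⟩ := hxA U hU hxU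
    have := hlt y hy hne
    rw [h0] at this
    exact absurd this not_lt_zero
  · refine ⟨U, hU, hxU, b, by simp [← hb], fun y hy hby => ?_⟩
    by_cases e : y = x
    · rwa [e]
    · have := hlt y hy e
      rw [← hb, Order.lt_succ_iff] at this
      exact absurd hby this.not_gt
  · have hV : IsOpen[τ] (@closure X τ A)ᶜ := isClosed_closure.isOpen_compl
    have hnot : ¬ IsOpen[τ] (insert x (@closure X τ A)ᶜ) := by
      intro ho
      obtain ⟨a, ha, haA, hne⟩ := hxA _ ho (Set.mem_insert _ _)
      exact (ha.resolve_left hne) (subset_closure haA)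
    have := mt (hm.isOpen_insert H hl hV) hnot
    push Not at this
    obtain ⟨N, hN, hxN, β, hβ, hbd⟩ := this
    refine ⟨N, hN, hxN, β, hβ, fun y hy hβy => mem_derivedSet_iff_open.2 fun M hM hyM => ?_⟩
    obtain ⟨z, ⟨hzM, hzN⟩, hz⟩ := H.hit y (M ∩ N) (hM.inter hN) ⟨hyM, hy⟩ β hβy
    have hzA : z ∈ @closure X τ A := by
      by_contra hzA
      exact (hbd z hzN hzA).ne hz
    -- Restricting to ranks below that of `y` ensures that the point of `A` found differs from `y`.
    obtain ⟨a, ⟨haM, hlt⟩, haA⟩ := mem_closure_iff.1 hzA (M ∩ {w | h w < h y})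
      (hM.inter (H.isOpen_lt _)) ⟨hzM, by simpa [hz] using hβy⟩
    exact ⟨a, haM, haA, fun e => by simp [e] at hlt⟩

/-- The next topology of an `ℓ`-maximal topology is generated by the topology and the sets of
points of rank greater than a given ordinal. -/
lemma IsLMaximal.isOpen_next_iff {τ : TopologicalSpace X} {h : X → Ordinal.{u}}
    (hm : IsLMaximal τ) (H : IsRankFn τ h) {U : Set X} :
    IsOpen[nextTopology τ] U ↔ ∀ x ∈ U, ∃ N, IsOpen[τ] N ∧ x ∈ N ∧
      ∃ a : WithBot Ordinal.{u}, a < h x ∧ ∀ y ∈ N, a < h y → y ∈ U := by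
  constructor
  -- The value `⊥` means that no rank bound is imposed; a strict bound by an ordinal could never
  -- hold at rank `0`.
  · let σ : TopologicalSpace X :=
      { IsOpen := fun U => ∀ x ∈ U, ∃ N, IsOpen[τ] N ∧ x ∈ N ∧
          ∃ a : WithBot Ordinal.{u}, a < h x ∧ ∀ y ∈ N, a < h y → y ∈ U
        isOpen_univ := fun x _ => ⟨Set.univ, isOpen_univ, trivial, ⊥, WithBot.bot_lt_coe _,
          fun _ _ _ => trivial⟩
        isOpen_inter := by
          rintro U U' h1 h1' x ⟨hx, hx'⟩
          obtain ⟨N, hN, hxN, a, ha, hNU⟩ := h1 x hx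
          obtain ⟨N', hN', hxN', a', ha', hNU'⟩ := h1' x hx'
          refine ⟨N ∩ N', hN.inter hN', ⟨hxN, hxN'⟩, max a a', max_lt ha ha', fun y hy hya => ?_⟩
          rw [max_lt_iff] at hya
          exact ⟨hNU y hy.1 hya.1, hNU' y hy.2 hya.2⟩
        isOpen_sUnion := by
          rintro S hS x ⟨U, hU, hx⟩
          obtain ⟨N, hN, hxN, a, ha, hNU⟩ := hS U hU x hx
          exact ⟨N, hN, hxN, a, ha, fun y hy hya => ⟨U, hU, hNU y hy hya⟩⟩ }
    have hle : σ ≤ nextTopology τ := by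
      refine le_generateFrom ?_
      rintro W (hW | ⟨A, rfl⟩) x hx
      · exact ⟨W, hW, hx, ⊥, WithBot.bot_lt_coe _, fun y hy _ => hy⟩
      · obtain ⟨N, hN, hxN, a, ha, hNA⟩ := hm.derivedSet_nhds H hx
        exact ⟨N, hN, hxN, a, WithBot.coe_lt_coe.2 ha,
          fun y hy hya => hNA y hy (WithBot.coe_lt_coe.1 hya)⟩
    exact fun hU => hle U hU
  · intro hU
    refine isOpen_of_local fun x hx => ?_
    obtain ⟨N, hN, hxN, a, ha, hNU⟩ := hU x hx
    induction a with
    | bot => exact ⟨N, nextTopology_le τ N hN, hxN, fun y hy => hNU y hy (WithBot.bot_lt_coe _)⟩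
    | coe a =>
      exact ⟨N ∩ {y | a < h y}, isOpen_inter_of (nextTopology_le τ N hN) (H.isOpen_next_gt a),
        ⟨hxN, WithBot.coe_lt_coe.1 ha⟩, fun y hy => hNU y hy.1 (WithBot.coe_lt_coe.2 hy.2)⟩

/-! ### Open subspaces -/

/-- `i` identifies `O` with a `τ`-open set. -/
structure IsOpenInj (τ : TopologicalSpace Z) (i : O → Z) : Prop where
  inj : Function.Injective i
  isOpen_range : IsOpen[τ] (Set.range i)

namespace IsOpenInj

variable {τ : TopologicalSpace Z} {i : O → Z}

lemma mono {τ' : TopologicalSpace Z} (hi : IsOpenInj τ i) (h : τ' ≤ τ) : IsOpenInj τ' i :=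
  ⟨hi.inj, h _ hi.isOpen_range⟩

lemma isOpen_induced (hi : IsOpenInj τ i) {U : Set O} :
    IsOpen[TopologicalSpace.induced i τ] U ↔ IsOpen[τ] (i '' U) := by
  rw [isOpen_induced_iff]
  constructor
  · rintro ⟨V, hV, rfl⟩
    rw [Set.image_preimage_eq_inter_range]
    exact hV.inter hi.isOpen_range
  · exact fun h => ⟨_, h, Set.preimage_image_eq U hi.inj⟩

lemma isDMap (hi : IsOpenInj τ i) : IsDMap (TopologicalSpace.induced i τ) τ i :=
  isDMap_iff.2 ⟨fun _ hV => isOpen_induced_preimage hV,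
    fun _ hU => hi.isOpen_induced.1 hU,
    fun _ => ⟨Set.univ, @isOpen_univ O (TopologicalSpace.induced i τ), trivial,
      fun _ _ e => hi.inj e⟩⟩

lemma isRankFn (hi : IsOpenInj τ i) {h : Z → Ordinal.{u}} (H : IsRankFn τ h) :
    IsRankFn (TopologicalSpace.induced i τ) (h ∘ i) :=
  H.comp_isDMap hi.isDMap

lemma isLExtension_induced (hi : IsOpenInj τ i) {τ' : TopologicalSpace Z} {h : Z → Ordinal.{u}}
    (H : IsRankFn τ h) (hτ : IsLExtension τ τ') :
    IsLExtension (TopologicalSpace.induced i τ) (TopologicalSpace.induced i τ') := by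
  have hi' := hi.mono hτ.extends_base
  refine (hi.isRankFn H).isLExtension (induced_mono hτ.extends_base)
    (hi'.isRankFn (IsLExtension.isRankFn H hτ)).hit fun U hU x hx hl => ?_
  obtain ⟨V, hV, hxV, hVU⟩ := hτ.nhds_of_not_limit _ (hi'.isOpen_induced.1 hU) (i x) ⟨x, hx, rfl⟩
    (by rwa [H.rank_eq])
  refine ⟨i ⁻¹' V, isOpen_induced_preimage hV, hxV, fun y hy => ?_⟩
  obtain ⟨z, hz, e⟩ := hVU hy
  rwa [← hi.inj e]

/-- An `ℓ`-extension of the topology of an open subspace extends to the whole space without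
changing the topology away from that subspace. -/
lemma exists_extension (hi : IsOpenInj τ i) {h : Z → Ordinal.{u}} (H : IsRankFn τ h)
    {t : TopologicalSpace O} (ht : IsLExtension (TopologicalSpace.induced i τ) t) :
    ∃ τ', IsLExtension τ τ' ∧ TopologicalSpace.induced i τ' = t ∧
      ∀ (O' : Type u) (j : O' → Z), IsOpenInj τ j → Disjoint (Set.range i) (Set.range j) →
        TopologicalSpace.induced j τ' = TopologicalSpace.induced j τ := by
  let τ' : TopologicalSpace Z :=
    { IsOpen := fun U => (∀ y ∈ U, y ∉ Set.range i → ∃ W, IsOpen[τ] W ∧ y ∈ W ∧ W ⊆ U) ∧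
        IsOpen[t] (i ⁻¹' U)
      isOpen_univ := ⟨fun y _ _ => ⟨Set.univ, isOpen_univ, trivial, subset_rfl⟩, isOpen_univ⟩
      isOpen_inter := by
        rintro U U' ⟨h1, h2⟩ ⟨h1', h2'⟩
        refine ⟨fun y hy hne => ?_, h2.inter h2'⟩
        obtain ⟨W, hW, hyW, hWU⟩ := h1 y hy.1 hne
        obtain ⟨W', hW', hyW', hWU'⟩ := h1' y hy.2 hne
        exact ⟨W ∩ W', hW.inter hW', ⟨hyW, hyW'⟩, Set.inter_subset_inter hWU hWU'⟩
      isOpen_sUnion := by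
        intro S hS
        refine ⟨?_, ?_⟩
        · rintro y ⟨U, hU, hy⟩ hne
          obtain ⟨W, hW, hyW, hWU⟩ := (hS U hU).1 y hy hne
          exact ⟨W, hW, hyW, hWU.trans (Set.subset_sUnion_of_mem hU)⟩
        · rw [Set.preimage_sUnion]
          exact isOpen_biUnion fun U hU => (hS U hU).2 }
  have hle : τ' ≤ τ := fun U hU => ⟨fun y hy _ => ⟨U, hU, hy, subset_rfl⟩,
    ht.extends_base _ (isOpen_induced_preimage hU)⟩
  refine ⟨τ', H.isLExtension hle ?_ ?_, ?_, ?_⟩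
  · intro x U hU hx β hβ
    by_cases hxi : x ∈ Set.range i
    · obtain ⟨o, rfl⟩ := hxi
      obtain ⟨y, hy, e⟩ := (IsLExtension.isRankFn (hi.isRankFn H) ht).hit o _ hU.2 hx β hβ
      exact ⟨i y, hy, e⟩
    · obtain ⟨W, hW, hxW, hWU⟩ := hU.1 x hx hxi
      obtain ⟨y, hy, e⟩ := H.hit x W hW hxW β hβ
      exact ⟨y, hWU hy, e⟩
  · intro U hU x hx hl
    by_cases hxi : x ∈ Set.range i
    · obtain ⟨o, rfl⟩ := hxi
      obtain ⟨V, hV, hoV, hVU⟩ := ht.nhds_of_not_limit _ hU.2 o hx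
        (by rwa [(hi.isRankFn H).rank_eq])
      exact ⟨i '' V, hi.isOpen_induced.1 hV, ⟨o, hoV, rfl⟩, Set.image_subset_iff.2 hVU⟩
    · exact hU.1 x hx hxi
  · refine TopologicalSpace.ext_iff.2 fun U => ?_
    rw [(hi.mono hle).isOpen_induced]
    constructor
    · intro hU
      have := hU.2
      rwa [Set.preimage_image_eq U hi.inj] at this
    · intro hU
      refine ⟨fun y hy hne => absurd (Set.image_subset_range _ _ hy) hne, ?_⟩
      rwa [Set.preimage_image_eq U hi.inj]
  · intro O' j hj hd
    refine TopologicalSpace.ext_iff.2 fun U => ?_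
    rw [(hj.mono hle).isOpen_induced, hj.isOpen_induced]
    refine ⟨fun hU => isOpen_of_local fun x hx => hU.1 x hx fun hxi => ?_, fun hU => hle _ hU⟩
    exact Set.disjoint_left.1 hd hxi (Set.image_subset_range _ _ hx)

end IsOpenInj

/-! ### Lifting along `d`-maps -/

lemma isOpen_inf_induced {τ : TopologicalSpace X} {θ : TopologicalSpace Y} {r : X → Y} {U : Set X}
    (hU : IsOpen[τ ⊓ TopologicalSpace.induced r θ] U) {x : X} (hx : x ∈ U) :
    ∃ N V, IsOpen[τ] N ∧ IsOpen[θ] V ∧ x ∈ N ∧ r x ∈ V ∧ N ∩ r ⁻¹' V ⊆ U := by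
  have h1 : U ∈ @nhds X (τ ⊓ TopologicalSpace.induced r θ) x :=
    @IsOpen.mem_nhds X (τ ⊓ TopologicalSpace.induced r θ) _ _ hU hx
  rw [nhds_inf, Filter.mem_inf_iff] at h1
  obtain ⟨A, hA, B, hB, rfl⟩ := h1
  rw [nhds_induced, Filter.mem_comap] at hB
  obtain ⟨C, hC, hCB⟩ := hB
  obtain ⟨N, hNA, hN, hxN⟩ := mem_nhds_iff.1 hA
  obtain ⟨V, hVC, hV, hxV⟩ := mem_nhds_iff.1 hC
  exact ⟨N, V, hN, hV, hxN, hxV, fun y hy => ⟨hNA hy.1, hCB (hVC hy.2)⟩⟩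

/-- Adjoining the preimages of `θ'`-open sets keeps `r` open, because the image of `N ∩ r ⁻¹' V` is
`r '' N ∩ V`. So `r` is a d-map to `θ'`, and ranks upstairs are pulled back from below. -/
lemma IsDMap.isLExtension_inf {τ : TopologicalSpace X} {θ θ' : TopologicalSpace Y} {r : X → Y}
    (hr : IsDMap τ θ r) {h : Y → Ordinal.{u}} (H : IsRankFn θ h) (hθ : IsLExtension θ θ') :
    IsLExtension τ (τ ⊓ TopologicalSpace.induced r θ') ∧
      IsDMap (τ ⊓ TopologicalSpace.induced r θ') θ' r := by
  obtain ⟨h1, h2, h3⟩ := isDMap_iff.1 hr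
  have hd : IsDMap (τ ⊓ TopologicalSpace.induced r θ') θ' r := by
    refine isDMap_iff.2 ⟨fun V hV => ?_, fun U hU => isOpen_of_local ?_, fun x => ?_⟩
    · exact (inf_le_right : τ ⊓ TopologicalSpace.induced r θ' ≤ _) _
        (isOpen_induced_preimage hV)
    · rintro _ ⟨x, hx, rfl⟩
      obtain ⟨N, V, hN, hV, hxN, hxV, hNU⟩ := isOpen_inf_induced hU hx
      refine ⟨r '' N ∩ V, IsOpen.inter (hθ.extends_base _ (h2 N hN)) hV,
        ⟨⟨x, hxN, rfl⟩, hxV⟩, ?_⟩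
      rintro _ ⟨⟨y, hy, rfl⟩, hyV⟩
      exact ⟨y, hNU ⟨hy, hyV⟩, rfl⟩
    · obtain ⟨U, hU, hxU, hinj⟩ := h3 x
      exact ⟨U, (inf_le_left : τ ⊓ TopologicalSpace.induced r θ' ≤ _) _ hU, hxU, hinj⟩
  refine ⟨(H.comp_isDMap hr).isLExtension inf_le_left
    ((IsLExtension.isRankFn H hθ).comp_isDMap hd).hit fun U hU x hx hl => ?_, hd⟩
  obtain ⟨N, V, hN, hV, hxN, hxV, hNU⟩ := isOpen_inf_induced hU hx
  obtain ⟨W, hW, hxW, hWV⟩ := hθ.nhds_of_not_limit V hV (r x) hxV (by rwa [H.rank_eq])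
  exact ⟨N ∩ r ⁻¹' W, hN.inter (h1 W hW), ⟨hxN, hxW⟩, fun y hy => hNU ⟨hy.1, hWV hy.2⟩⟩

/-- A `d`-map to an `ℓ`-maximal space remains one under `ℓ`-extensions of its domain. -/
lemma IsDMap.of_isLExtension {τ τ' : TopologicalSpace X} {θ : TopologicalSpace Y} {r : X → Y}
    (hr : IsDMap τ θ r) {h : Y → Ordinal.{u}} (H : IsRankFn θ h) (hm : IsLMaximal θ)
    (hτ : IsLExtension τ τ') : IsDMap τ' θ r := by
  obtain ⟨h1, h2, h3⟩ := isDMap_iff.1 hr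
  have Hτ := H.comp_isDMap hr
  have Hτ' := IsLExtension.isRankFn Hτ hτ
  -- Openness of `r` is proved by induction on rank. At limit rank the image of the lower-rank part
  -- of `U` is open by induction and `IsLMaximal.isOpen_insert` adds `r x`; at other ranks `τ'` has
  -- no new neighbourhoods.
  have key : ∀ α : Ordinal.{u}, ∀ x U, h (r x) = α → IsOpen[τ'] U → x ∈ U →
      ∃ V, IsOpen[θ] V ∧ r x ∈ V ∧ V ⊆ r '' U := by
    intro α
    induction α using WellFoundedLT.induction with
    | _ α ih =>
      intro x U hxα hU hx
      by_cases hl : Order.IsSuccLimit α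
      · have hU₀ : IsOpen[τ'] (U ∩ {y | h (r y) < α}) := hU.inter (Hτ'.isOpen_lt α)
        have hV₀ : IsOpen[θ] (r '' (U ∩ {y | h (r y) < α})) := by
          refine isOpen_of_local ?_
          rintro _ ⟨y, hy, rfl⟩
          exact ih _ hy.2 y _ rfl hU₀ hy
        refine ⟨_, hm.isOpen_insert H (x := r x) (by rwa [hxα]) hV₀ ?_, Set.mem_insert _ _, ?_⟩
        · intro N hN hxN β hβ
          obtain ⟨z, ⟨hzU, hzN⟩, hz⟩ := Hτ'.hit x (U ∩ r ⁻¹' N)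
            (hU.inter (hτ.extends_base _ (h1 N hN))) ⟨hx, hxN⟩ β hβ
          have hz' : h (r z) = β := hz
          refine ⟨r z, hzN, ⟨z, ⟨hzU, ?_⟩, rfl⟩, hz'.ge⟩
          rw [Set.mem_ofPred_eq, hz', ← hxα]
          exact hβ
        · rintro _ (rfl | ⟨y, hy, rfl⟩)
          · exact ⟨x, hx, rfl⟩
          · exact ⟨y, hy.1, rfl⟩
      · obtain ⟨V, hV, hxV, hVU⟩ := hτ.nhds_of_not_limit U hU x hx
          (by rw [Hτ.rank_eq]; simpa [hxα] using hl)
        exact ⟨r '' V, h2 V hV, ⟨x, hxV, rfl⟩, Set.image_mono hVU⟩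
  refine isDMap_iff.2 ⟨fun V hV => hτ.extends_base _ (h1 V hV), fun U hU => isOpen_of_local ?_,
    fun x => ?_⟩
  · rintro _ ⟨x, hx, rfl⟩
    exact key _ x U rfl hU hx
  · obtain ⟨U, hU, hxU, hinj⟩ := h3 x
    exact ⟨U, hτ.extends_base _ hU, hxU, hinj⟩

variable {O₁ O₂ Y₁ Y₂ : Type u}

/-- Simultaneous lifting of `ℓ`-maximal `ℓ`-extensions along `d`-maps defined on two disjoint
open subspaces. -/
theorem exists_isLMaximalLExtension_lift {τ : TopologicalSpace Z} (hs : IsScattered τ)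
    {i₁ : O₁ → Z} {i₂ : O₂ → Z} (hi₁ : IsOpenInj τ i₁) (hi₂ : IsOpenInj τ i₂)
    (hd : Disjoint (Set.range i₁) (Set.range i₂)) {r₁ : O₁ → Y₁} {r₂ : O₂ → Y₂}
    {θ₁ θ₁' : TopologicalSpace Y₁} {θ₂ θ₂' : TopologicalSpace Y₂}
    (hs₁ : IsScattered θ₁) (hs₂ : IsScattered θ₂)
    (hr₁ : IsDMap (TopologicalSpace.induced i₁ τ) θ₁ r₁)
    (hr₂ : IsDMap (TopologicalSpace.induced i₂ τ) θ₂ r₂)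
    (h₁ : IsLMaximalLExtension θ₁ θ₁') (h₂ : IsLMaximalLExtension θ₂ θ₂') :
    ∃ τ', IsLMaximalLExtension τ τ' ∧ IsDMap (TopologicalSpace.induced i₁ τ') θ₁' r₁ ∧
      IsDMap (TopologicalSpace.induced i₂ τ') θ₂' r₂ := by
  have H := hs.isRankFn
  have H₁ := hs₁.isRankFn
  have H₂ := hs₂.isRankFn
  -- The two pieces are refined one after the other; disjointness keeps each refinement from
  -- disturbing the other piece. A final ℓ-maximal extension preserves both d-maps because their
  -- targets are ℓ-maximal.
  obtain ⟨e₁, d₁⟩ := hr₁.isLExtension_inf H₁ h₁.1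
  obtain ⟨τa, hτa, ha₁, ha₂⟩ := hi₁.exists_extension H e₁
  have Ha := IsLExtension.isRankFn H hτa
  have hr₂a : IsDMap (TopologicalSpace.induced i₂ τa) θ₂ r₂ := by
    rwa [ha₂ _ i₂ hi₂ hd]
  obtain ⟨e₂, d₂⟩ := hr₂a.isLExtension_inf H₂ h₂.1
  have hi₁a := hi₁.mono hτa.extends_base
  have hi₂a := hi₂.mono hτa.extends_base
  obtain ⟨τb, hτb, hb₂, hb₁⟩ := hi₂a.exists_extension Ha e₂
  have Hb := IsLExtension.isRankFn Ha hτb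
  have hi₁b := hi₁a.mono hτb.extends_base
  have hi₂b := hi₂a.mono hτb.extends_base
  obtain ⟨τ', hτ', hmax⟩ := Hb.isScattered.exists_isLMaximalLExtension
  refine ⟨τ', ⟨(hτa.trans hτb).trans hτ', hmax⟩, ?_, ?_⟩
  · refine IsDMap.of_isLExtension ?_ (IsLExtension.isRankFn H₁ h₁.1) h₁.2
      (hi₁b.isLExtension_induced Hb hτ')
    rwa [hb₁ _ i₁ hi₁a hd.symm, ha₁]
  · refine IsDMap.of_isLExtension ?_ (IsLExtension.isRankFn H₂ h₂.1) h₂.2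
      (hi₂b.isLExtension_induced Hb hτ')
    rwa [hb₂]

/-- A `d`-map from an open subspace of an `ℓ`-maximal space to an `ℓ`-maximal space is a `d`-map
for the next topologies. -/
lemma IsDMap.next {τ : TopologicalSpace Z} {θ : TopologicalSpace Y} {i : O → Z}
    (hi : IsOpenInj τ i) {r : O → Y} (hr : IsDMap (TopologicalSpace.induced i τ) θ r)
    (hs : IsScattered τ) (hs' : IsScattered θ) (hm : IsLMaximal τ) (hm' : IsLMaximal θ) :
    IsDMap (TopologicalSpace.induced i (nextTopology τ)) (nextTopology θ) r := by
  have H := hs.isRankFn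
  have H' := hs'.isRankFn
  have hi' := hi.mono (nextTopology_le τ)
  -- Rank bounds agree on both sides of `r`, so the local description in
  -- `IsLMaximal.isOpen_next_iff` transfers in either direction.
  have hrank : ∀ o, rank τ (i o) = rank θ (r o) := by
    intro o
    exact (congrFun (hi.isRankFn H).rank_eq o).symm.trans
      (congrFun (H'.comp_isDMap hr).rank_eq o)
  obtain ⟨h1, h2, h3⟩ := isDMap_iff.1 hr
  refine isDMap_iff.2 ⟨fun V hV => ?_, fun U hU => ?_, fun x => ?_⟩
  · rw [hi'.isOpen_induced, hm.isOpen_next_iff H]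
    rintro _ ⟨o, ho, rfl⟩
    obtain ⟨N, hN, hoN, a, ha, hNV⟩ := (hm'.isOpen_next_iff H').1 hV (r o) ho
    refine ⟨i '' (r ⁻¹' N), hi.isOpen_induced.1 (h1 N hN), ⟨o, hoN, rfl⟩, a, by rwa [hrank], ?_⟩
    rintro _ ⟨p, hp, rfl⟩ hap
    exact ⟨p, hNV _ hp (by rwa [← hrank]), rfl⟩
  · rw [hi'.isOpen_induced, hm.isOpen_next_iff H] at hU
    rw [hm'.isOpen_next_iff H']
    rintro _ ⟨o, ho, rfl⟩
    obtain ⟨N, hN, hoN, a, ha, hNU⟩ := hU (i o) ⟨o, ho, rfl⟩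
    refine ⟨r '' (i ⁻¹' N), h2 _ (isOpen_induced_preimage hN), ⟨o, hoN, rfl⟩, a,
      by rwa [← hrank], ?_⟩
    rintro _ ⟨p, hp, rfl⟩ hap
    obtain ⟨q, hq, e⟩ := hNU (i p) hp (by rwa [hrank])
    exact ⟨p, hi.inj e ▸ hq, rfl⟩
  · obtain ⟨U, hU, hxU, hinj⟩ := h3 x
    exact ⟨U, induced_mono (nextTopology_le τ) _ hU, hxU, hinj⟩

/-! ### Lme-sequences, their lifting, and the rank map as a d-map. -/

/-- An infinite lme-sequence based on a scattered topology. -/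
structure IsLMESeq (base : TopologicalSpace X) (τ : ℕ → TopologicalSpace X) : Prop where
  scattered_base : IsScattered base
  zero : IsLMaximalLExtension base (τ 0)
  succ : ∀ k, IsLMaximalLExtension (nextTopology (τ k)) (τ (k + 1))

namespace IsLMESeq

variable {base : TopologicalSpace X} {τ : ℕ → TopologicalSpace X}

lemma succ_le (h : IsLMESeq base τ) (k : ℕ) : τ (k + 1) ≤ nextTopology (τ k) :=
  (h.succ k).1.extends_base

lemma le_base (h : IsLMESeq base τ) (k : ℕ) : τ k ≤ base := by
  induction k with
  | zero => exact h.zero.1.extends_base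
  | succ k ih => exact (h.succ_le k).trans ((nextTopology_le _).trans ih)

lemma isScattered (h : IsLMESeq base τ) (k : ℕ) : IsScattered (τ k) :=
  h.scattered_base.mono (h.le_base k)

lemma isLMaximal (h : IsLMESeq base τ) (k : ℕ) : IsLMaximal (τ k) := by
  cases k with
  | zero => exact h.zero.2
  | succ k => exact (h.succ k).2

lemma tail (h : IsLMESeq base τ) : IsLMESeq (nextTopology (τ 0)) (fun k => τ (k + 1)) :=
  ⟨(h.isScattered 0).mono (nextTopology_le _), h.succ 0, fun k => h.succ (k + 1)⟩

lemma cons {σ : TopologicalSpace X} (hs : IsScattered base) (hσ : IsLMaximalLExtension base σ)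
    (h : IsLMESeq (nextTopology σ) τ) : IsLMESeq base (fun k => Nat.casesOn k σ τ) :=
  ⟨hs, hσ, fun k => by
    cases k with
    | zero => exact h.zero
    | succ k => exact h.succ k⟩

end IsLMESeq

/-- Lifting of lme-sequences along `d`-maps defined on two disjoint open subspaces. -/
theorem exists_isLMESeq_lift {τ : TopologicalSpace Z} (hs : IsScattered τ)
    {i₁ : O₁ → Z} {i₂ : O₂ → Z} (hi₁ : IsOpenInj τ i₁) (hi₂ : IsOpenInj τ i₂)
    (hd : Disjoint (Set.range i₁) (Set.range i₂)) {r₁ : O₁ → Y₁} {r₂ : O₂ → Y₂}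
    {θ₁ : TopologicalSpace Y₁} {θ₂ : TopologicalSpace Y₂}
    (hr₁ : IsDMap (TopologicalSpace.induced i₁ τ) θ₁ r₁)
    (hr₂ : IsDMap (TopologicalSpace.induced i₂ τ) θ₂ r₂)
    {υ₁ : ℕ → TopologicalSpace Y₁} {υ₂ : ℕ → TopologicalSpace Y₂}
    (h₁ : IsLMESeq θ₁ υ₁) (h₂ : IsLMESeq θ₂ υ₂) :
    ∃ σ : ℕ → TopologicalSpace Z, IsLMESeq τ σ ∧
      (∀ k, IsDMap (TopologicalSpace.induced i₁ (σ k)) (υ₁ k) r₁) ∧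
      ∀ k, IsDMap (TopologicalSpace.induced i₂ (σ k)) (υ₂ k) r₂ := by
  let P : ℕ → TopologicalSpace Z → Prop := fun k σ => σ ≤ τ ∧ IsLMaximal σ ∧
    IsDMap (TopologicalSpace.induced i₁ σ) (υ₁ k) r₁ ∧
    IsDMap (TopologicalSpace.induced i₂ σ) (υ₂ k) r₂
  obtain ⟨σ₀, hσ₀, hσ₁, hσ₂⟩ := exists_isLMaximalLExtension_lift hs hi₁ hi₂ hd h₁.scattered_base
    h₂.scattered_base hr₁ hr₂ h₁.zero h₂.zero
  have hP₀ : P 0 σ₀ := ⟨hσ₀.1.extends_base, hσ₀.2, hσ₁, hσ₂⟩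
  have step : ∀ k σ, P k σ → ∃ σ', P (k + 1) σ' ∧ IsLMaximalLExtension (nextTopology σ) σ' := by
    rintro k σ ⟨hle, hm, hd₁, hd₂⟩
    have hle' := (nextTopology_le σ).trans hle
    have n₁ := hd₁.next (hi₁.mono hle) (hs.mono hle) (h₁.isScattered k) hm (h₁.isLMaximal k)
    have n₂ := hd₂.next (hi₂.mono hle) (hs.mono hle) (h₂.isScattered k) hm (h₂.isLMaximal k)
    obtain ⟨σ', hσ', d₁, d₂⟩ := exists_isLMaximalLExtension_lift (hs.mono hle') (hi₁.mono hle')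
      (hi₂.mono hle') hd ((h₁.isScattered k).mono (nextTopology_le _))
      ((h₂.isScattered k).mono (nextTopology_le _)) n₁ n₂ (h₁.succ k) (h₂.succ k)
    exact ⟨σ', ⟨hσ'.1.extends_base.trans hle', hσ'.2, d₁, d₂⟩, hσ'⟩
  choose! F hF hF' using step
  let σ : ℕ → TopologicalSpace Z := fun k => Nat.rec σ₀ F k
  have hσ : ∀ k, P k (σ k) := fun k => by
    induction k with
    | zero => exact hP₀
    | succ k ih => exact hF k _ ih
  exact ⟨σ, ⟨hs, hσ₀, fun k => hF' k _ (hσ k)⟩, fun k => (hσ k).2.2.1, fun k => (hσ k).2.2.2⟩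

/-- The rank function, restricted to the points of rank at least `η` and normalized to take
values in a well-order, is a `d`-map from the next topology to the order topology. -/
lemma isDMap_rank_next {L : Type v} [LinearOrder L] [WellFoundedLT L] {τ : TopologicalSpace Z}
    {h : Z → Ordinal.{u}} (H : IsRankFn τ h) (hm : IsLMaximal τ) {η : Ordinal.{u}}
    (hη : ¬ Order.IsSuccLimit η) {i : O → Z} (hi : Function.Injective i)
    (hrange : Set.range i = {x | η ≤ h x}) {r : O → L} (hsurj : Function.Surjective r)
    (hlt : ∀ x y, r x < r y ↔ h (i x) < h (i y)) :
    IsOpenInj (nextTopology τ) i ∧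
      IsDMap (TopologicalSpace.induced i (nextTopology τ)) (Preorder.topology L) r := by
  have hopen : IsOpen[nextTopology τ] (Set.range i) := by
    rw [hrange]
    rcases Ordinal.zero_or_succ_or_isSuccLimit η with rfl | ⟨b, rfl⟩ | hl
    · simp
    · simpa only [Order.succ_le_iff] using H.isOpen_next_gt b
    · exact absurd hl hη
  have hi' : IsOpenInj (nextTopology τ) i := ⟨hi, hopen⟩
  have heq : ∀ x y, h (i x) = h (i y) → r x = r y := fun x y e =>
    le_antisymm (not_lt.1 fun h' => ((hlt _ _).1 h').ne' e)
      (not_lt.1 fun h' => ((hlt _ _).1 h').ne e)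
  refine ⟨hi', ?_⟩
  let _ := Preorder.topology L
  have : OrderTopology L := ⟨rfl⟩
  -- In a well-order a proper lower set is the initial segment below the least element of its
  -- complement.
  have hlower : ∀ s : Set L, IsLowerSet s → IsOpen s := by
    intro s hs
    by_cases e : sᶜ.Nonempty
    · have : s = Set.Iio (wellFounded_lt.min sᶜ e) := by
        ext a
        refine ⟨fun ha => not_le.1 fun hle => ?_, fun ha => ?_⟩
        · exact wellFounded_lt.min_mem sᶜ e (hs hle ha)
        · by_contra hna
          exact wellFounded_lt.not_lt_min sᶜ hna ha
      rw [this]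
      exact isOpen_Iio
    · rw [Set.not_nonempty_iff_eq_empty, Set.compl_empty_iff] at e
      rw [e]
      exact isOpen_univ
  refine isDMap_iff.2 ⟨?_, ?_, ?_⟩
  · have : Continuous[TopologicalSpace.induced i (nextTopology τ), Preorder.topology L] r := by
      refine continuous_generateFrom_iff.2 ?_
      rintro _ ⟨b, rfl | rfl⟩
      · obtain ⟨y, rfl⟩ := hsurj b
        refine ⟨_, H.isOpen_next_gt (h (i y)), ?_⟩
        ext x
        exact (hlt y x).symm
      · obtain ⟨y, rfl⟩ := hsurj b
        refine ⟨_, nextTopology_le τ _ (H.isOpen_lt (h (i y))), ?_⟩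
        ext x
        exact (hlt x y).symm
    exact fun V hV => continuous_def.1 this V hV
  · intro U hU
    rw [hi'.isOpen_induced, hm.isOpen_next_iff H] at hU
    refine isOpen_of_local ?_
    rintro _ ⟨x, hx, rfl⟩
    obtain ⟨N, hN, hxN, a, ha, hNU⟩ := hU (i x) ⟨x, hx, rfl⟩
    have hNl : IsOpen (r '' (i ⁻¹' N)) := by
      refine hlower _ ?_
      rintro _ b hb ⟨y, hy, rfl⟩
      rcases hb.eq_or_lt with rfl | hb
      · exact ⟨y, hy, rfl⟩
      · obtain ⟨z, rfl⟩ := hsurj b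
        obtain ⟨w, hw, e⟩ := H.hit (i y) N hN hy _ ((hlt z y).1 hb)
        have hwr : w ∈ Set.range i := by
          rw [hrange, Set.mem_ofPred_eq, e]
          exact hrange.subset (Set.mem_range_self z)
        obtain ⟨w, rfl⟩ := hwr
        exact ⟨w, hw, heq _ _ e⟩
    -- If `a` is not a rank occurring on the range of `i`, it lies below `η`, since `N` takes all
    -- ranks below that of `i x`. The bound is then void on the range.
    by_cases hex : ∃ z, a = h (i z)
    · obtain ⟨z, rfl⟩ := hex
      refine ⟨r '' (i ⁻¹' N) ∩ Set.Ioi (r z), hNl.inter isOpen_Ioi,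
        ⟨⟨x, hxN, rfl⟩, (hlt z x).2 (WithBot.coe_lt_coe.1 ha)⟩, ?_⟩
      rintro _ ⟨⟨y, hy, rfl⟩, hzy⟩
      obtain ⟨y', hy', e⟩ := hNU (i y) hy (WithBot.coe_lt_coe.2 ((hlt z y).1 hzy))
      exact ⟨y, hi e ▸ hy', rfl⟩
    · refine ⟨r '' (i ⁻¹' N), hNl, ⟨x, hxN, rfl⟩, ?_⟩
      rintro _ ⟨y, hy, rfl⟩
      have hay : a < h (i y) := by
        induction a with
        | bot => exact WithBot.bot_lt_coe _
        | coe a =>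
          refine WithBot.coe_lt_coe.2 (lt_of_lt_of_le (not_le.1 fun hle => hex ?_)
            (hrange.subset (Set.mem_range_self y)))
          obtain ⟨w, -, e⟩ := H.hit (i x) N hN hxN a (WithBot.coe_lt_coe.1 ha)
          have hwr : w ∈ Set.range i := by
            rw [hrange, Set.mem_ofPred_eq, e]
            exact hle
          obtain ⟨w, rfl⟩ := hwr
          exact ⟨w, by rw [e]⟩
      obtain ⟨y', hy', e⟩ := hNU (i y) hy hay
      exact ⟨y, hi e ▸ hy', rfl⟩
  · intro x
    obtain ⟨U, hU, hxU, hiso⟩ := H.isolated (i x)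
    refine ⟨i ⁻¹' U, isOpen_induced_preimage (nextTopology_le τ _ hU), hxU,
      fun y hy e => hi (hiso _ hy (not_lt.1 fun h' => ?_))⟩
    exact ((hlt y x).2 h').ne e

end GLPSpaces

namespace GLPSpaces

/-! ### Ordinal arithmetic -/

section Arithmetic

open Ordinal Order

lemma ordinal_mul_lt_mul_iff {a b c : Ordinal.{u}} (ha : 0 < a) : a * b < a * c ↔ b < c :=
  (isNormal_mul_right ha).strictMono.lt_iff_lt

lemma ordinal_mul_le_mul_iff {a b c : Ordinal.{u}} (ha : 0 < a) : a * b ≤ a * c ↔ b ≤ c :=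
  (isNormal_mul_right ha).strictMono.le_iff_le

/-- The exponent `ε` is that of the last term of the Cantor normal form; the induction strips
leading terms until only one is left. -/
lemma exists_eq_omega0_opow_mul_succ (γ : Ordinal.{u}) (hγ : γ ≠ 0) :
    ∃ ε ξ : Ordinal.{u}, γ = ω ^ ε * succ ξ := by
  induction γ using CNF.rec ω with
  | H0 => exact absurd rfl hγ
  | H o ho ih =>
    set l := log ω o
    have hpos : (0 : Ordinal.{u}) < ω ^ l := opow_pos _ omega0_pos
    have hdec := div_add_mod o (ω ^ l)
    set q := o / ω ^ l with hq
    by_cases hr : o % ω ^ l = 0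
    · rw [hr, add_zero] at hdec
      have hqω : q < ω := by
        rw [hq, ← lt_mul_iff_div_lt hpos.ne', ← opow_succ]
        exact lt_opow_succ_log_self one_lt_omega0 o
      rcases zero_or_succ_or_isSuccLimit q with h0 | ⟨ξ, hξ⟩ | hl
      · rw [h0, mul_zero] at hdec
        exact absurd hdec.symm ho
      · exact ⟨l, ξ, by rw [hξ, hdec]⟩
      · exact absurd (omega0_le_of_isSuccLimit hl) hqω.not_ge
    · obtain ⟨ε, ξ, hε⟩ := ih hr
      have hlt : o % ω ^ l < ω ^ l := mod_lt _ hpos.ne'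
      have hle : ω ^ ε ≤ o % ω ^ l := by
        rw [hε]
        exact le_mul_left _ (bot_lt_succ ξ)
      have hεl : ε ≤ l :=
        ((opow_lt_opow_iff_right one_lt_omega0).1 (hle.trans_lt hlt)).le
      refine ⟨ε, ω ^ (l - ε) * q + ξ, ?_⟩
      rw [succ_eq_add_one, add_assoc, ← succ_eq_add_one, mul_add, ← mul_assoc, ← opow_add, Ordinal.add_sub_cancel_of_le hεl, ← hε,
        hdec]

lemma omega0_opow_dvd_iff {ε δ ξ : Ordinal.{u}} : ω ^ δ ∣ ω ^ ε * succ ξ ↔ δ ≤ ε := by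
  constructor
  · intro h
    by_contra! hlt
    have h1 : ω ^ ε * ω ∣ ω ^ ε * succ ξ := by
      rw [← opow_succ]
      exact (opow_dvd_opow _ (succ_le_of_lt hlt)).trans h
    obtain ⟨c, hc⟩ := h1
    rw [mul_assoc] at hc
    have h2 : succ ξ = ω * c := (isNormal_mul_right (opow_pos ε omega0_pos)).strictMono.injective hc
    have h3 : IsSuccPrelimit (succ ξ) := isSuccPrelimit_iff_omega0_dvd.2 ⟨c, h2⟩
    exact not_isSuccPrelimit_succ ξ h3
  · intro h
    exact (opow_dvd_opow _ h).trans (dvd_mul_right _ _)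

/-- The greatest `ε` such that `ω ^ ε` divides `γ`. -/
noncomputable def lastExp (γ : Ordinal.{u}) : Ordinal.{u} := sSup {ε | ω ^ ε ∣ γ}

lemma lastExp_mul_succ (ε ξ : Ordinal.{u}) : lastExp (ω ^ ε * succ ξ) = ε := by
  have : {δ | ω ^ δ ∣ ω ^ ε * succ ξ} = Set.Iic ε := by
    ext δ
    exact omega0_opow_dvd_iff
  rw [lastExp, this, csSup_Iic]

lemma lastExp_omega0_opow (ε : Ordinal.{u}) : lastExp (ω ^ ε) = ε := by
  simpa using lastExp_mul_succ ε 0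

lemma omega0_opow_dvd_iff_le_lastExp {γ δ : Ordinal.{u}} (hγ : γ ≠ 0) :
    ω ^ δ ∣ γ ↔ δ ≤ lastExp γ := by
  obtain ⟨ε, ξ, rfl⟩ := exists_eq_omega0_opow_mul_succ γ hγ
  rw [omega0_opow_dvd_iff, lastExp_mul_succ]

/-- The multiple of `ω ^ ε` preceding `ω ^ ε * succ ξ` is `ω ^ ε * ξ`, and nothing in between is
divisible by `ω ^ ε`. With `exists_lastExp_eq` this makes `lastExp` behave as the rank for the order
topology. -/
lemma exists_lastExp_lt {γ : Ordinal.{u}} (hγ : γ ≠ 0) :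
    ∃ a < γ, ∀ γ', a < γ' → γ' < γ → lastExp γ' < lastExp γ := by
  obtain ⟨ε, ξ, rfl⟩ := exists_eq_omega0_opow_mul_succ γ hγ
  have hpos : (0 : Ordinal.{u}) < ω ^ ε := opow_pos _ omega0_pos
  refine ⟨ω ^ ε * ξ, (ordinal_mul_lt_mul_iff hpos).2 (lt_succ ξ), fun γ' h1 h2 => ?_⟩
  rw [lastExp_mul_succ]
  by_contra! hle
  obtain ⟨c, rfl⟩ := (omega0_opow_dvd_iff_le_lastExp (ne_bot_of_gt h1)).2 hle
  rw [ordinal_mul_lt_mul_iff hpos] at h1 h2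
  exact h1.not_ge (lt_succ_iff.1 h2)

lemma exists_lastExp_eq {γ ε a : Ordinal.{u}} (hγ : γ ≠ 0) (hε : ε < lastExp γ) (ha : a < γ) :
    ∃ γ', a < γ' ∧ γ' < γ ∧ lastExp γ' = ε := by
  have hpos : (0 : Ordinal.{u}) < ω ^ ε := opow_pos _ omega0_pos
  -- The first multiple of `ω ^ ε` beyond `a`. It cannot reach `γ`, whose last exponent is larger.
  refine ⟨ω ^ ε * succ (a / ω ^ ε), lt_mul_succ_div a hpos.ne', ?_, lastExp_mul_succ _ _⟩
  obtain ⟨ζ, hζ⟩ := (omega0_opow_dvd_iff_le_lastExp hγ).2 hε.le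
  refine lt_of_le_of_ne ?_ fun e => ?_
  · rw [hζ, lt_mul_iff_div_lt hpos.ne'] at ha
    conv_rhs => rw [hζ]
    exact (ordinal_mul_le_mul_iff hpos).2 (succ_le_of_lt ha)
  · rw [← e, lastExp_mul_succ] at hε
    exact hε.false

lemma lastExp_le {γ κ : Ordinal.{u}} (hγ : γ ≠ 0) (h : γ ≤ ω ^ κ) : lastExp γ ≤ κ := by
  have := le_of_dvd hγ ((omega0_opow_dvd_iff_le_lastExp hγ).2 le_rfl)
  exact (opow_le_opow_iff_right one_lt_omega0).1 (this.trans h)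

lemma eq_of_lastExp_eq {γ κ : Ordinal.{u}} (hγ : γ ≠ 0) (h : γ ≤ ω ^ κ) (e : lastExp γ = κ) :
    γ = ω ^ κ :=
  le_antisymm h (le_of_dvd hγ ((omega0_opow_dvd_iff_le_lastExp hγ).2 e.ge))

lemma omega0_opow_lt_epsilon_zero {a : Ordinal.{u}} (h : a < ε₀) : ω ^ a < ε₀ := by
  rw [← omega0_opow_epsilon 0]
  exact (opow_lt_opow_iff_right one_lt_omega0).2 h

lemma mul_lt_epsilon_zero {a b : Ordinal.{u}} (ha : a < ε₀) (hb : b < ε₀) : a * b < ε₀ := by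
  have : ε₀ = ω ^ ω ^ (ε₀ : Ordinal.{u}) := by rw [omega0_opow_epsilon, omega0_opow_epsilon]
  rw [this] at ha hb ⊢
  exact isPrincipal_mul_omega0_opow_opow _ ha hb

lemma add_lt_epsilon_zero {a b : Ordinal.{u}} (ha : a < ε₀) (hb : b < ε₀) : a + b < ε₀ := by
  have : ε₀ = ω ^ (ε₀ : Ordinal.{u}) := by rw [omega0_opow_epsilon]
  rw [this] at ha hb ⊢
  exact isPrincipal_add_omega0_opow _ ha hb

/-- Division with remainder in `(0, μ]` instead of `[0, μ)`, so that blocks are copies of `[1, μ]`.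
It makes the folding map of `exists_cone_space` well determined. -/
lemma mul_add_inj {μ δ δ' y y' : Ordinal.{u}} (h : μ * δ + y = μ * δ' + y') (hy : 0 < y)
    (hyμ : y ≤ μ) (hy' : 0 < y') (hyμ' : y' ≤ μ) : y = y' := by
  have key : ∀ {δ δ' y y' : Ordinal.{u}}, y ≤ μ → 0 < y' → δ < δ' →
      μ * δ + y < μ * δ' + y' := by
    intro δ δ' y y' hyμ hy' hδ
    calc μ * δ + y ≤ μ * δ + μ := by gcongr
      _ = μ * succ δ := (mul_succ _ _).symm
      _ ≤ μ * δ' := by gcongr; exact succ_le_of_lt hδ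
      _ < μ * δ' + y' := lt_add_of_pos_right _ hy'
  rcases lt_trichotomy δ δ' with hlt | rfl | hlt
  · exact absurd h (key hyμ hy' hlt).ne
  · exact add_left_cancel h
  · exact absurd h (key hyμ' hy hlt).ne'

lemma not_mul_omega0_dvd_mul_add {μ δ y : Ordinal.{u}} (hy : 0 < y) (hyμ : y ≤ μ) :
    ¬ μ * ω ∣ μ * δ + y := by
  rintro ⟨c, hc⟩
  have hμ : 0 < μ := hy.trans_le hyμ
  rw [mul_assoc] at hc
  have h1 : μ * δ < μ * (ω * c) := hc ▸ lt_add_of_pos_right _ hy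
  rw [ordinal_mul_lt_mul_iff hμ] at h1
  have hl : IsSuccLimit (ω * c) := isSuccLimit_iff.2
    ⟨(ne_bot_of_gt h1), isSuccPrelimit_iff_omega0_dvd.2 (dvd_mul_right _ _)⟩
  have h2 : μ * δ + y ≤ μ * succ δ := by
    rw [mul_succ]
    gcongr
  rw [hc, ordinal_mul_le_mul_iff hμ] at h2
  exact (hl.succ_lt h1).not_ge h2

lemma exists_eq_mul_add {μ x : Ordinal.{u}} (hμ : μ ≠ 0) (hx : ¬ μ * ω ∣ x) :
    ∃ δ y, 0 < y ∧ y ≤ μ ∧ x = μ * δ + y := by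
  have hdec := div_add_mod x μ
  by_cases h0 : x % μ = 0
  · rw [h0, add_zero] at hdec
    have hnl : ¬ ω ∣ x / μ := fun ⟨c, hc⟩ => hx ⟨c, by rw [mul_assoc, ← hc, hdec]⟩
    rcases zero_or_succ_or_isSuccLimit (x / μ) with h | ⟨ξ, hξ⟩ | hl
    · exact absurd (h ▸ dvd_zero ω) hnl
    · exact ⟨ξ, μ, pos_iff_ne_zero.2 hμ, le_rfl, by rw [← mul_succ, hξ, hdec]⟩
    · exact absurd (isSuccPrelimit_iff_omega0_dvd.1 hl.isSuccPrelimit) hnl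
  · exact ⟨x / μ, x % μ, pos_iff_ne_zero.2 h0, (mod_lt _ hμ).le, hdec.symm⟩

end Arithmetic

/-! ### Intervals of ordinals -/

lemma induced_val_eq (lam : Ordinal.{u}) :
    TopologicalSpace.induced (Subtype.val : Set.Icc 1 lam → Ordinal.{u}) inferInstance =
      Preorder.topology (Set.Icc 1 lam) :=
  (orderTopology_of_ordConnected (t := Set.Icc 1 lam)).topology_eq_generate_intervals

lemma isOpen_Ioc_Icc {lam : Ordinal.{u}} (a b : Ordinal.{u}) :
    IsOpen[Preorder.topology (Set.Icc 1 lam)] {y | a < y.1 ∧ y.1 ≤ b} := by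
  rw [← induced_val_eq]
  refine ⟨Set.Ioo a (Order.succ b), isOpen_Ioo, ?_⟩
  ext y
  simp

lemma exists_Ioc_subset_Icc {lam : Ordinal.{u}} {U : Set (Set.Icc 1 lam)}
    (hU : IsOpen[Preorder.topology (Set.Icc 1 lam)] U) {x : Set.Icc 1 lam} (hx : x ∈ U) :
    ∃ a < x.1, ∀ y : Set.Icc 1 lam, a < y.1 → y.1 ≤ x.1 → y ∈ U := by
  rw [← induced_val_eq] at hU
  obtain ⟨V, hV, rfl⟩ := hU
  obtain ⟨a, ha, h⟩ := exists_Ioc_subset_of_mem_nhds (hV.mem_nhds hx)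
    ⟨0, zero_lt_one.trans_le x.2.1⟩
  exact ⟨a, ha, fun y h1 h2 => h ⟨h1, h2⟩⟩

/-- Translation by `a`, as a map between intervals of ordinals. -/
def shift {a μ lam : Ordinal.{u}} (h : a + μ ≤ lam) (y : Set.Icc 1 μ) : Set.Icc 1 lam :=
  ⟨a + y.1, y.2.1.trans le_add_self, (by gcongr; exact y.2.2 : a + y.1 ≤ a + μ).trans h⟩

lemma range_shift {a μ lam : Ordinal.{u}} (h : a + μ ≤ lam) :
    Set.range (shift h) = {y | a < y.1 ∧ y.1 ≤ a + μ} := by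
  ext x
  constructor
  · rintro ⟨y, rfl⟩
    exact ⟨lt_add_of_pos_right _ (zero_lt_one.trans_le y.2.1), by
      simp only [shift]; gcongr; exact y.2.2⟩
  · rintro ⟨h1, h2⟩
    have e := Ordinal.add_sub_cancel_of_le h1.le
    refine ⟨⟨x.1 - a, ?_, ?_⟩, Subtype.ext e⟩
    · rw [Order.one_le_iff_pos, ← not_le, Ordinal.sub_le]
      simpa using h1
    · rwa [Ordinal.sub_le]

lemma isOpenInj_shift {a μ lam : Ordinal.{u}} (h : a + μ ≤ lam) :
    IsOpenInj (Preorder.topology (Set.Icc 1 lam)) (shift h) := by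
  refine ⟨fun x y e => Subtype.ext (add_left_cancel (congrArg Subtype.val e)), ?_⟩
  rw [range_shift]
  exact isOpen_Ioc_Icc _ _

lemma induced_shift {a μ lam : Ordinal.{u}} (h : a + μ ≤ lam) :
    TopologicalSpace.induced (shift h) (Preorder.topology (Set.Icc 1 lam)) =
      Preorder.topology (Set.Icc 1 μ) := by
  let _ := Preorder.topology (Set.Icc 1 lam)
  let _ := Preorder.topology (Set.Icc 1 μ)
  have : OrderTopology (Set.Icc 1 lam) := ⟨rfl⟩
  have : OrderTopology (Set.Icc 1 μ) := ⟨rfl⟩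
  have hm : StrictMono (shift h) := fun x y hxy =>
    (by simp only [shift]; gcongr : (shift h x).1 < (shift h y).1)
  refine (hm.isEmbedding_of_ordConnected ?_).eq_induced.symm
  rw [range_shift]
  exact ⟨fun x hx y hy z hz => ⟨hx.1.trans_le hz.1, (show z.1 ≤ y.1 from hz.2).trans hy.2⟩⟩

/-- The space replacing the isolated points of `[1, ω ^ κ]` by copies of a sum of `ω` copies of
`[1, μ]`: the remaining points form the set `C`, with exponents `e`, and `c` is the folding map. -/
theorem exists_cone_space {μ κ : Ordinal.{u}} (hμ : μ < ε₀) (hκ : κ < ε₀) :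
    ∃ lam : Ordinal.{u}, lam < ε₀ ∧ ∃ (C : Set (Set.Icc 1 lam)) (c : ↥Cᶜ → Set.Icc 1 μ)
      (e : Set.Icc 1 lam → Ordinal.{u}),
      IsOpen[Preorder.topology (Set.Icc 1 lam)] Cᶜ ∧
      IsDMap (TopologicalSpace.induced Subtype.val (Preorder.topology (Set.Icc 1 lam)))
        (Preorder.topology (Set.Icc 1 μ)) c ∧
      (∀ x ∈ C, ∀ U, IsOpen[Preorder.topology (Set.Icc 1 lam)] U → x ∈ U →
        ∀ y, ∃ o : ↥Cᶜ, o.1 ∈ U ∧ c o = y) ∧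
      (∀ x ∈ C, ∃ U, IsOpen[Preorder.topology (Set.Icc 1 lam)] U ∧ x ∈ U ∧
        ∀ y ∈ U, y ∈ C → y ≠ x → e y < e x) ∧
      (∀ x ∈ C, ∀ U, IsOpen[Preorder.topology (Set.Icc 1 lam)] U → x ∈ U →
        ∀ ε < e x, ∃ y ∈ U, y ∈ C ∧ e y = ε) ∧
      (∀ x ∈ C, e x ≤ κ) ∧
      ∃ t ∈ C, t.1 = lam ∧ e t = κ ∧ ∀ x ∈ C, e x = κ → x = t := by
  classical
  -- For `μ = 0` there is nothing to insert, and the value `1` makes `C` the whole interval.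
  let β : Ordinal.{u} := if μ = 0 then 1 else μ * ω
  have hβ : 0 < β := by
    simp only [β]
    split_ifs with h
    · exact zero_lt_one
    · exact mul_pos (pos_iff_ne_zero.2 h) Ordinal.omega0_pos
  have hβε : β < ε₀ := by
    simp only [β]
    split_ifs with h
    · simpa using Ordinal.natCast_lt_epsilon 1 0
    · exact mul_lt_epsilon_zero hμ (Ordinal.omega0_lt_epsilon 0)
  have hβμ : μ ≠ 0 → β = μ * ω := fun h => if_neg h
  let lam := β * ω ^ κ
  have hpow : (0 : Ordinal.{u}) < ω ^ κ := Ordinal.opow_pos _ Ordinal.omega0_pos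
  have hlam : 1 ≤ lam := Order.one_le_iff_pos.2 (mul_pos hβ hpow)
  let C : Set (Set.Icc 1 lam) := {x | β ∣ x.1}
  let e : Set.Icc 1 lam → Ordinal.{u} := fun x => lastExp (x.1 / β)
  have hCdec : ∀ x ∈ C, ∃ γ, γ ≠ 0 ∧ γ ≤ ω ^ κ ∧ x.1 = β * γ ∧ e x = lastExp γ := by
    rintro ⟨x, hx1, hx2⟩ ⟨γ, hγ⟩
    dsimp only at hγ
    subst hγ
    refine ⟨γ, ?_, (ordinal_mul_le_mul_iff hβ).1 hx2, rfl, ?_⟩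
    · rintro rfl
      simp at hx1
    · simp only [e, Ordinal.mul_div_cancel γ hβ.ne']
  have hmk : ∀ γ, γ ≠ 0 → ∀ h : β * γ ∈ Set.Icc 1 lam,
      (⟨β * γ, h⟩ : Set.Icc 1 lam) ∈ C ∧ e ⟨β * γ, h⟩ = lastExp γ := fun γ _ h =>
    ⟨dvd_mul_right _ _, by simp only [e, Ordinal.mul_div_cancel γ hβ.ne']⟩
  have hOdec : ∀ x : ↥Cᶜ, ∃ (y : Set.Icc 1 μ) (δ : Ordinal.{u}) (h : μ * δ + μ ≤ lam),
      shift h y = x.1 := by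
    rintro ⟨x, hx⟩
    have hμ0 : μ ≠ 0 := by
      rintro rfl
      exact hx (by simp [C, β])
    have hx' : ¬ μ * ω ∣ x.1 := by rw [← hβμ hμ0]; exact hx
    obtain ⟨δ, y, hy, hyμ, hxy⟩ := exists_eq_mul_add hμ0 hx'
    refine ⟨⟨y, Order.one_le_iff_pos.2 hy, hyμ⟩, δ, ?_, Subtype.ext hxy.symm⟩
    have h1 : μ * δ < μ * (ω * ω ^ κ) := by
      rw [← mul_assoc, ← hβμ hμ0]
      exact (hxy ▸ lt_add_of_pos_right _ hy : μ * δ < x.1).trans_le x.2.2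
    rw [ordinal_mul_lt_mul_iff (pos_iff_ne_zero.2 hμ0)] at h1
    rw [← Ordinal.mul_succ]
    simp only [lam]
    rw [hβμ hμ0, mul_assoc, ordinal_mul_le_mul_iff (pos_iff_ne_zero.2 hμ0)]
    exact Order.succ_le_of_lt h1
  have hshift : ∀ (y : Set.Icc 1 μ) (δ : Ordinal.{u}) (h : μ * δ + μ ≤ lam), shift h y ∈ Cᶜ := by
    intro y δ h
    have hy := Order.one_le_iff_pos.1 y.2.1
    have := not_mul_omega0_dvd_mul_add (δ := δ) hy y.2.2
    rw [← hβμ (hy.trans_le y.2.2).ne'] at this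
    exact this
  choose c D hD hc using hOdec
  have hcs : ∀ (y : Set.Icc 1 μ) (δ : Ordinal.{u}) (h : μ * δ + μ ≤ lam),
      c ⟨shift h y, hshift y δ h⟩ = y := by
    intro y δ h
    have h1 := congrArg Subtype.val (hc ⟨shift h y, hshift y δ h⟩)
    exact Subtype.ext (mul_add_inj h1 (Order.one_le_iff_pos.1 (c _).2.1) (c _).2.2
      (Order.one_le_iff_pos.1 y.2.1) y.2.2)
  have hO : IsOpen[Preorder.topology (Set.Icc 1 lam)] Cᶜ := by
    refine isOpen_of_local fun x hx => ?_
    -- Between the last multiple of `β` below `x` and `x` itself there is no further multiple.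
    refine ⟨_, isOpen_Ioc_Icc (β * (x.1 / β)) x.1, ⟨?_, le_rfl⟩, ?_⟩
    · exact lt_of_le_of_ne (Ordinal.mul_div_le _ _) fun h => hx ⟨_, h.symm⟩
    · rintro y ⟨h1, h2⟩ ⟨γ, hγ⟩
      rw [hγ, ordinal_mul_lt_mul_iff hβ] at h1
      have h3 := h2.trans_lt (Ordinal.lt_mul_succ_div x.1 hβ.ne')
      rw [hγ, ordinal_mul_lt_mul_iff hβ, Order.lt_succ_iff] at h3
      exact h1.not_ge h3
  have hOi : IsOpenInj (Preorder.topology (Set.Icc 1 lam)) (Subtype.val : ↥Cᶜ → _) :=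
    ⟨Subtype.val_injective, by rwa [Subtype.range_coe]⟩
  refine ⟨lam, mul_lt_epsilon_zero hβε (omega0_opow_lt_epsilon_zero hκ), C, c, e, hO,
    isDMap_iff.2 ⟨?_, ?_, ?_⟩, ?_, ?_, ?_, ?_, ?_⟩
  · intro V hV
    refine hOi.isOpen_induced.2 (isOpen_of_local ?_)
    rintro _ ⟨x, hx, rfl⟩
    refine ⟨shift (hD x) '' V, (isOpenInj_shift (hD x)).isOpen_induced.1
      (by rwa [induced_shift]), ⟨c x, hx, hc x⟩, ?_⟩
    rintro _ ⟨y, hy, rfl⟩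
    exact ⟨⟨_, hshift y _ (hD x)⟩, by rw [Set.mem_preimage, hcs]; exact hy, rfl⟩
  · intro U hU
    rw [hOi.isOpen_induced] at hU
    refine isOpen_of_local ?_
    rintro _ ⟨x, hx, rfl⟩
    refine ⟨shift (hD x) ⁻¹' (Subtype.val '' U), ?_, ⟨x, hx, (hc x).symm⟩, ?_⟩
    · rw [← induced_shift (hD x)]
      exact isOpen_induced_preimage hU
    · rintro y ⟨z, hz, hzy⟩
      refine ⟨z, hz, ?_⟩
      have : z = ⟨shift (hD x) y, hshift y _ (hD x)⟩ := Subtype.ext hzy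
      rw [this, hcs]
  · intro x
    refine ⟨Subtype.val ⁻¹' Set.range (shift (hD x)),
      isOpen_induced_preimage (isOpenInj_shift (hD x)).isOpen_range, ⟨_, hc x⟩, ?_⟩
    rintro z ⟨y, hy⟩ hzx
    have : z = ⟨shift (hD x) y, hshift y _ (hD x)⟩ := Subtype.ext hy.symm
    rw [this, hcs] at hzx
    exact Subtype.ext (by rw [← hy, hzx, hc])
  · intro x hx U hU hxU y
    obtain ⟨γ, hγ, -, hxγ, -⟩ := hCdec x hx
    obtain ⟨a, ha, haU⟩ := exists_Ioc_subset_Icc hU hxU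
    have hμ0 : 0 < μ := (Order.one_le_iff_pos.1 y.2.1).trans_le y.2.2
    rw [hxγ, hβμ hμ0.ne', mul_assoc] at ha
    have h1 := (Ordinal.lt_mul_iff_div_lt hμ0.ne').1 ha
    have hl : Order.IsSuccLimit (ω * γ) := Ordinal.isSuccLimit_mul_left
      Ordinal.isSuccLimit_omega0 (pos_iff_ne_zero.2 hγ)
    -- Two successor steps: the block with index `succ (a / μ)` starts beyond `a`, and the second
    -- step ensures that it also ends by `x`.
    have h2 := (hl.succ_lt (hl.succ_lt h1)).le
    rw [← ordinal_mul_le_mul_iff hμ0, Ordinal.mul_succ, ← mul_assoc, ← hβμ hμ0.ne', ← hxγ] at h2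
    have h3 := h2.trans x.2.2
    refine ⟨⟨shift h3 y, hshift y _ h3⟩, haU _ ?_ ?_, hcs y _ h3⟩
    · exact (Ordinal.lt_mul_succ_div a hμ0.ne').trans_le le_self_add
    · refine le_trans ?_ h2
      simp only [shift]
      gcongr
      exact y.2.2
  · intro x hx
    obtain ⟨γ, hγ, -, hxγ, he⟩ := hCdec x hx
    obtain ⟨a, ha, hlt⟩ := exists_lastExp_lt hγ
    refine ⟨_, isOpen_Ioc_Icc (β * a) x.1, ⟨?_, le_rfl⟩, ?_⟩
    · rwa [hxγ, ordinal_mul_lt_mul_iff hβ]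
    · rintro y ⟨h1, h2⟩ hy hne
      obtain ⟨γ', -, -, hyγ, he'⟩ := hCdec y hy
      have h3 : y.1 < x.1 := lt_of_le_of_ne h2 fun h => hne (Subtype.ext h)
      rw [hyγ, ordinal_mul_lt_mul_iff hβ] at h1
      rw [hyγ, hxγ, ordinal_mul_lt_mul_iff hβ] at h3
      rw [he, he']
      exact hlt γ' h1 h3
  · intro x hx U hU hxU ε hε
    obtain ⟨γ, hγ, -, hxγ, he⟩ := hCdec x hx
    obtain ⟨a, ha, haU⟩ := exists_Ioc_subset_Icc hU hxU
    rw [hxγ, Ordinal.lt_mul_iff_div_lt hβ.ne'] at ha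
    obtain ⟨γ', h1, h2, h3⟩ := exists_lastExp_eq hγ (he ▸ hε) ha
    have hγ' : γ' ≠ 0 := ne_bot_of_gt h1
    have h4 : β * γ' ≤ x.1 := by
      rw [hxγ]
      exact ((ordinal_mul_lt_mul_iff hβ).2 h2).le
    have hm : β * γ' ∈ Set.Icc 1 lam :=
      ⟨Order.one_le_iff_pos.2 (mul_pos hβ (pos_iff_ne_zero.2 hγ')), h4.trans x.2.2⟩
    refine ⟨⟨β * γ', hm⟩, haU _ ?_ h4, (hmk γ' hγ' hm).1, (hmk γ' hγ' hm).2.trans h3⟩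
    exact (Ordinal.lt_mul_succ_div a hβ.ne').trans_le
      ((ordinal_mul_le_mul_iff hβ).2 (Order.succ_le_of_lt h1))
  · intro x hx
    obtain ⟨γ, hγ, hle, -, he⟩ := hCdec x hx
    rw [he]
    exact lastExp_le hγ hle
  · have hm : β * ω ^ κ ∈ Set.Icc 1 lam := ⟨hlam, le_rfl⟩
    refine ⟨⟨_, hm⟩, (hmk _ hpow.ne' hm).1, rfl, (hmk _ hpow.ne' hm).2.trans
      (lastExp_omega0_opow κ), fun x hx hxκ => ?_⟩
    obtain ⟨γ, hγ, hle, hxγ, he⟩ := hCdec x hx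
    exact Subtype.ext (hxγ.trans (by rw [eq_of_lastExp_eq hγ hle (he ▸ hxκ)]))

end GLPSpaces

/-! ### Lme-sequences on cones. -/

namespace GLPSpaces

lemma isScattered_Icc (lam : Ordinal.{u}) : IsScattered (Preorder.topology (Set.Icc 1 lam)) := by
  intro A hA
  obtain ⟨x, hx, hmin⟩ := (wellFounded_lt (α := Set.Icc 1 lam)).has_min A hA
  refine ⟨x, hx, _, isOpen_Ioc_Icc 0 x.1, ?_⟩
  ext y
  constructor
  · rintro ⟨⟨-, h⟩, hy⟩
    exact le_antisymm h (not_lt.1 (hmin y hy))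
  · rintro rfl
    exact ⟨⟨zero_lt_one.trans_le y.2.1, le_rfl⟩, hx⟩

lemma IsLMESeq.of_subsingleton {X : Type u} [Subsingleton X] (base : TopologicalSpace X)
    (τ : ℕ → TopologicalSpace X) : IsLMESeq base τ := by
  have h : ∀ σ σ' : TopologicalSpace X, IsLMaximalLExtension σ σ' := fun σ σ' =>
    ⟨Subsingleton.elim σ σ' ▸ IsLExtension.refl σ, fun _ _ => Subsingleton.elim _ _⟩
  refine ⟨fun A ⟨x, hx⟩ => ⟨x, hx, Set.univ, @isOpen_univ X base, ?_⟩, h _ _, fun _ => h _ _⟩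
  ext y
  simp [Subsingleton.elim y x, hx]

/-- The ranks of a compact interval of ordinals have a strict supremum that is not a limit. -/
lemma exists_rank_bound {μ : Ordinal.{u}} {h : Set.Icc 1 μ → Ordinal.{u + 1}}
    (H : IsRankFn (Preorder.topology (Set.Icc 1 μ)) h) :
    ∃ η, ¬ Order.IsSuccLimit η ∧ (∀ y, h y < η) ∧ ∀ α < η, ∃ y, h y = α := by
  have hne : {α | ∀ y, h y < α}.Nonempty := by
    obtain ⟨b, hb⟩ := Ordinal.bddAbove_of_small (s := Set.range h)
    exact ⟨Order.succ b, fun y => Order.lt_succ_of_le (hb ⟨y, rfl⟩)⟩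
  have hη := csInf_mem hne
  set η := sInf {α | ∀ y, h y < α} with hηdef
  have hmin : ∀ α < η, ∃ y, α ≤ h y := by
    intro α hα
    by_contra! hc
    exact (csInf_le' (s := {α | ∀ y, h y < α}) hc).not_gt hα
  refine ⟨η, fun hl => ?_, hη, fun α hα => ?_⟩
  · let _ : TopologicalSpace (Set.Icc 1 μ) := Preorder.topology (Set.Icc 1 μ)
    -- If `η` were a limit, the open sets of points of rank below `α < η` would form a directed
    -- cover; compactness would bound all ranks below `η`.
    have hcomp : IsCompact (Set.univ : Set (Set.Icc 1 μ)) := by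
      have h1 : @IsCompact (Set.Icc 1 μ)
          (TopologicalSpace.induced Subtype.val inferInstance) Set.univ :=
        isCompact_iff_isCompact_univ.1 (isCompact_Icc (a := 1) (b := μ))
      rwa [induced_val_eq] at h1
    have hpos : 0 < η := pos_iff_ne_zero.2 hl.ne_bot
    have : Nonempty (Set.Iio η) := ⟨⟨0, hpos⟩⟩
    obtain ⟨α, hα⟩ := hcomp.elim_directed_cover (fun α : Set.Iio η => {y | h y < α.1})
      (fun α => H.isOpen_lt α.1)
      (fun y _ => Set.mem_iUnion.2 ⟨⟨Order.succ (h y), hl.succ_lt (hη y)⟩, Order.lt_succ (h y)⟩)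
      (fun a b => ⟨max a b, fun y (hy : h y < a.1) => hy.trans_le
          (show a ≤ max a b from le_max_left _ _),
        fun y (hy : h y < b.1) => hy.trans_le (show b ≤ max a b from le_max_right _ _)⟩)
    obtain ⟨y, hy⟩ := hmin α.1 α.2
    exact (hα (Set.mem_univ y) : h y < α.1).not_ge hy
  · obtain ⟨y, hy⟩ := hmin α hα
    rcases hy.eq_or_lt with e | hlt
    · exact ⟨y, e.symm⟩
    · obtain ⟨z, -, e⟩ := H.hit y Set.univ (@isOpen_univ _ (Preorder.topology _)) trivial α hlt
      exact ⟨z, e⟩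

/-- The lme-space on a cone: the base `C` carries the lifted topologies of `[1, κ]` shifted by one
level, and its complement those of `[1, μ]`. -/
theorem exists_cone_lmeSeq {μ κ : Ordinal.{u}} (hμ : μ < ε₀) (hκ : κ < ε₀) (hκ1 : 1 ≤ κ)
    {υ : ℕ → TopologicalSpace (Set.Icc 1 μ)} {θ : ℕ → TopologicalSpace (Set.Icc 1 κ)}
    (hυ : IsLMESeq (Preorder.topology _) υ) (hθ : IsLMESeq (Preorder.topology _) θ) :
    ∃ lam : Ordinal.{u}, lam < ε₀ ∧ ∃ (C : Set (Set.Icc 1 lam)) (c : ↥Cᶜ → Set.Icc 1 μ)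
      (r : ↥C → Set.Icc 1 κ) (τ : ℕ → TopologicalSpace (Set.Icc 1 lam)),
      IsLMESeq (Preorder.topology _) τ ∧
      (∀ k, IsOpenInj (τ k) (Subtype.val : ↥Cᶜ → _)) ∧
      (∀ k, IsDMap (TopologicalSpace.induced Subtype.val (τ k)) (υ k) c) ∧
      (∀ k, IsOpenInj (τ (k + 1)) (Subtype.val : ↥C → _)) ∧
      (∀ k, IsDMap (TopologicalSpace.induced Subtype.val (τ (k + 1))) (θ k) r) ∧
      Function.Surjective r ∧
      (∀ x ∈ C, ∀ U, IsOpen[τ 0] U → x ∈ U → ∀ y, ∃ o : ↥Cᶜ, o.1 ∈ U ∧ c o = y) ∧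
      ∃ t : ↥C, t.1.1 = lam ∧ (r t).1 = κ ∧ ∀ x, (r x).1 = κ → x = t := by
  classical
  have hκ' : 1 + (κ - 1) = κ := Ordinal.add_sub_cancel_of_le hκ1
  -- Exponents start at `0` but `[1, κ]` starts at `1`, hence the exponent `κ - 1`, with `1 + (κ -
  -- 1) = κ`.
  obtain ⟨lam, hlam, C, c, e, hO, hc, hdense, hlt, hhit, hle, t, htC, htlam, het, htuniq⟩ :=
    exists_cone_space hμ ((Ordinal.sub_le_self κ 1).trans_lt hκ)
  have Hμ := (isScattered_Icc μ).isRankFn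
  obtain ⟨η, hη, hηlt, hηhit⟩ := exists_rank_bound Hμ
  set hY := rank (Preorder.topology (Set.Icc 1 μ))
  have hi₁ : IsOpenInj (Preorder.topology _) (Subtype.val : ↥Cᶜ → Set.Icc 1 lam) :=
    ⟨Subtype.val_injective, by rwa [Subtype.range_coe]⟩
  -- Points of `C` rank above every inserted copy. The lift is needed because intervals of ordinals
  -- live one universe higher than their elements.
  let h : Set.Icc 1 lam → Ordinal.{u + 1} := fun x =>
    if hx : x ∈ C then η + Ordinal.lift.{u + 1} (e x) else hY (c ⟨x, hx⟩)
  have hC : ∀ x ∈ C, h x = η + Ordinal.lift.{u + 1} (e x) := fun x hx => dif_pos hx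
  have hCc : ∀ x : ↥Cᶜ, h x.1 = hY (c x) := fun x => dif_neg x.2
  have hCη : ∀ x, x ∈ C ↔ η ≤ h x := by
    intro x
    constructor
    · intro hx
      rw [hC x hx]
      exact le_self_add
    · intro hx
      by_contra hxC
      rw [hCc ⟨x, hxC⟩] at hx
      exact (hηlt _).not_ge hx
  have Hc := Hμ.comp_isDMap hc
  have H : IsRankFn (Preorder.topology (Set.Icc 1 lam)) h := by
    refine ⟨fun x => ?_, fun x U hU hx β hβ => ?_⟩
    · by_cases hx : x ∈ C
      · obtain ⟨U, hU, hxU, hl⟩ := hlt x hx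
        refine ⟨U, hU, hxU, fun y hy hne => ?_⟩
        by_cases hyC : y ∈ C
        · rw [hC y hyC, hC x hx]
          gcongr
          exact Ordinal.lift_lt.2 <| hl y hy hyC hne
        · exact (not_le.1 (mt (hCη y).2 hyC)).trans_le ((hCη x).1 hx)
      · obtain ⟨U, hU, hxU, hl⟩ := Hc.lt ⟨x, hx⟩
        refine ⟨_, hi₁.isOpen_induced.1 hU, ⟨_, hxU, rfl⟩, ?_⟩
        rintro _ ⟨y, hy, rfl⟩ hne
        rw [hCc y, hCc ⟨x, hx⟩]
        exact hl y hy fun e => hne (congrArg Subtype.val e)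
    · by_cases hxC : x ∈ C
      · by_cases hβη : β < η
        · obtain ⟨y, rfl⟩ := hηhit β hβη
          obtain ⟨o, ho, rfl⟩ := hdense x hxC U hU hx y
          exact ⟨o.1, ho, hCc o⟩
        · rw [hC x hxC] at hβ
          have e1 := Ordinal.add_sub_cancel_of_le (not_lt.1 hβη)
          rw [← e1, add_lt_add_iff_left] at hβ
          obtain ⟨ε, hε⟩ := Ordinal.mem_range_lift_of_le hβ.le
          rw [← hε, Ordinal.lift_lt] at hβ
          obtain ⟨y, hy, hyC, rfl⟩ := hhit x hxC U hU hx ε hβ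
          exact ⟨y, hy, by rw [hC y hyC, hε, e1]⟩
      · rw [hCc ⟨x, hxC⟩] at hβ
        obtain ⟨y, hy, e⟩ := Hc.hit ⟨x, hxC⟩ (Subtype.val ⁻¹' U) (isOpen_induced_preimage hU) hx
          β hβ
        exact ⟨y.1, hy, (hCc y).trans e⟩
  have hs := H.isScattered
  -- At level `0` only the complement of `C` is known to be open, so the second piece of the lifting
  -- theorem is empty.
  let i₀ : PEmpty.{u + 2} → Set.Icc 1 lam := PEmpty.elim
  have hi₀ : IsOpenInj (Preorder.topology _) i₀ := by
    refine ⟨fun x => x.elim, ?_⟩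
    rw [Set.range_eq_empty]
    exact @isOpen_empty _ (Preorder.topology _)
  have hE := IsLMESeq.of_subsingleton (X := PEmpty.{u + 2}) ⊥ fun _ => ⊥
  obtain ⟨τ₀, hτ₀, hcτ₀, -⟩ := exists_isLMaximalLExtension_lift hs hi₁ hi₀
    (by rw [Set.range_eq_empty i₀]; exact Set.disjoint_empty _) (isScattered_Icc μ)
    hE.scattered_base hc (r₂ := id)
    (isDMap_iff.2 ⟨fun V _ => by
        rw [Set.eq_empty_of_isEmpty (id ⁻¹' V)]; exact @isOpen_empty _ (_),
      fun U _ => by rw [Set.eq_empty_of_isEmpty (id '' U)]; exact @isOpen_empty _ (_),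
      fun x => x.elim⟩) hυ.zero hE.zero
  have H₀ := IsLExtension.isRankFn H hτ₀.1
  have hle' : ∀ x : ↥C, 1 + e x.1 ≤ κ := fun x => by
    rw [← hκ']
    gcongr
    exact hle _ x.2
  let r : ↥C → Set.Icc 1 κ := fun x => ⟨1 + e x.1, le_self_add, hle' x⟩
  have hrsurj : Function.Surjective r := by
    rintro ⟨b, hb1, hbκ⟩
    have hb : 1 + (b - 1) = b := Ordinal.add_sub_cancel_of_le hb1
    have hb' : b - 1 ≤ κ - 1 := by
      rw [← hb, ← hκ', add_le_add_iff_left] at hbκ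
      exact hbκ
    rcases hb'.eq_or_lt with e1 | hlt'
    · exact ⟨⟨t, htC⟩, Subtype.ext (by simp only [r]; rw [het, ← e1, hb])⟩
    · obtain ⟨y, -, hyC, e1⟩ := hhit t htC Set.univ (@isOpen_univ _ (Preorder.topology _)) trivial
        (b - 1) (het ▸ hlt')
      exact ⟨⟨y, hyC⟩, Subtype.ext (by simp only [r]; rw [e1, hb])⟩
  obtain ⟨hi₂, hr⟩ := isDMap_rank_next (L := Set.Icc 1 κ) H₀ hτ₀.2 hη
    (Subtype.val_injective (p := (· ∈ C)))
    (by rw [Subtype.range_coe]; ext x; exact hCη x) hrsurj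
    (fun x y => by
      rw [hC _ x.2, hC _ y.2, add_lt_add_iff_left, Ordinal.lift_lt, ← Subtype.coe_lt_coe]
      simp only [r]
      rw [add_lt_add_iff_left])
  have hs₀ := hs.mono hτ₀.1.extends_base
  have hi₁₀ := hi₁.mono hτ₀.1.extends_base
  -- From `τ₀⁺` on both pieces are open: the tail of `υ` is lifted along `c` together with all of
  -- `θ` along `r`, which produces the shift by one level.
  obtain ⟨τ, hτ, hτ₁, hτ₂⟩ := exists_isLMESeq_lift (hs₀.mono (nextTopology_le τ₀))
    (hi₁₀.mono (nextTopology_le τ₀)) hi₂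
    (by rw [Subtype.range_coe, Subtype.range_coe]; exact disjoint_compl_left)
    (hcτ₀.next hi₁₀ hs₀ (hυ.isScattered 0) hτ₀.2 (hυ.isLMaximal 0)) hr hυ.tail hθ
  have hseq := IsLMESeq.cons hs hτ₀ hτ
  refine ⟨lam, hlam, C, c, r, _, hseq, fun k => hi₁.mono (hseq.le_base k), fun k => ?_,
    fun k => hi₂.mono (hτ.le_base k), hτ₂, hrsurj, ?_, ⟨t, htC⟩, htlam, ?_, ?_⟩
  · cases k with
    | zero => exact hcτ₀
    | succ k => exact hτ₁ k
  · intro x hx U hU hxU y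
    -- Density survives the passage to `τ₀`: `U` contains a point of `C` of rank exactly `η`, and
    -- since `η` is not a limit, `U` contains an order neighbourhood of that point.
    obtain ⟨z, hzU, hz⟩ : ∃ z ∈ U, h z = η := by
      rcases ((hCη x).1 hx).eq_or_lt with e1 | hlt'
      · exact ⟨x, hxU, e1.symm⟩
      · exact H₀.hit x U hU hxU η hlt'
    obtain ⟨V, hV, hzV, hVU⟩ := hτ₀.1.nhds_of_not_limit U hU z hzU (by rwa [H.rank_eq, hz])
    obtain ⟨o, ho, e1⟩ := hdense z ((hCη z).2 hz.ge) V hV hzV y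
    exact ⟨o, hVU ho, e1⟩
  · simp only [r]
    rw [het, hκ']
  · intro x hx
    simp only [r] at hx
    rw [← hκ', add_right_inj] at hx
    exact Subtype.ext (htuniq x.1 x.2 hx)

end GLPSpaces

namespace GLPSpaces

/-! ### Trees of sheets -/

section Realization

variable {T : Type v} {R : ℕ → T → T → Prop}

/-- The union of the relations `R i` with `k ≤ i`. -/
def RS (R : ℕ → T → T → Prop) (k : ℕ) (x y : T) : Prop := ∃ i, k ≤ i ∧ R i x y

/-- `x` and `y` lie in the same `k`-sheet. -/
def SameSheet (R : ℕ → T → T → Prop) (k : ℕ) : T → T → Prop := Relation.EqvGen (RS R k)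

lemma RS.mono {k l : ℕ} (h : k ≤ l) {x y : T} : RS R l x y → RS R k x y :=
  fun ⟨i, hi, hr⟩ => ⟨i, h.trans hi, hr⟩

lemma RS.cases {k : ℕ} {x y : T} : RS R k x y → R k x y ∨ RS R (k + 1) x y := by
  rintro ⟨i, hi, hr⟩
  rcases hi.eq_or_lt with rfl | hlt
  · exact Or.inl hr
  · exact Or.inr ⟨i, hlt, hr⟩

namespace SameSheet

lemma refl {k : ℕ} (x : T) : SameSheet R k x x := Relation.EqvGen.refl x

lemma symm {k : ℕ} {x y : T} (h : SameSheet R k x y) : SameSheet R k y x :=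
  Relation.EqvGen.symm _ _ h

lemma trans {k : ℕ} {x y z : T} (h : SameSheet R k x y) (h' : SameSheet R k y z) :
    SameSheet R k x z :=
  Relation.EqvGen.trans _ _ _ h h'

lemma of_RS {k : ℕ} {x y : T} (h : RS R k x y) : SameSheet R k x y := Relation.EqvGen.rel _ _ h

lemma of_rel {k : ℕ} {x y : T} (h : R k x y) : SameSheet R k x y := of_RS ⟨k, le_rfl, h⟩

lemma mono {k l : ℕ} (h : k ≤ l) {x y : T} (hxy : SameSheet R l x y) : SameSheet R k x y :=
  Relation.EqvGen.mono (fun _ _ => RS.mono h) _ _ hxy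

end SameSheet

/-- Pointwise form of the axioms of a `J`-tree whose relations `R k` with `N ≤ k` are empty. -/
structure IsSheetTree (R : ℕ → T → T → Prop) (N : ℕ) : Prop where
  bound : ∀ k, N ≤ k → ∀ x y, ¬ R k x y
  irrefl : ∀ k x, ¬ R k x x
  trans : ∀ k x y z, R k x y → R k y z → R k x z
  uniform : ∀ k x x' y y', SameSheet R (k + 1) x x' → SameSheet R (k + 1) y y' →
    R k x y → R k x' y'
  linear : ∀ k x y z, R k x z → R k y z → R k x y ∨ SameSheet R (k + 1) x y ∨ R k y x
  root : ∀ k x, ∃ r, SameSheet R k x r ∧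
    ∀ y, SameSheet R k x y → SameSheet R (k + 1) r y ∨ R k r y

namespace IsSheetTree

variable {N : ℕ}

lemma eq_of_sameSheet (hT : IsSheetTree R N) {k : ℕ} (hk : N ≤ k) {x y : T}
    (h : SameSheet R k x y) : x = y := by
  induction h with
  | rel x y h =>
    obtain ⟨i, hi, hr⟩ := h
    exact absurd hr (hT.bound i (hk.trans hi) x y)
  | refl => rfl
  | symm _ _ _ ih => exact ih.symm
  | trans _ _ _ _ _ hxy hyz => exact hxy.trans hyz

/-- Every sheet has a hereditary root. -/
lemma exists_root (hT : IsSheetTree R N) (k : ℕ) (x : T) :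
    ∃ w, SameSheet R k x w ∧ (∀ v, SameSheet R k x v → v ≠ w → RS R k w v) ∧
      ∀ v, ¬ RS R k v w := by
  by_cases hk : N ≤ k
  · exact ⟨x, .refl x, fun v hv hne => absurd (hT.eq_of_sameSheet hk hv).symm hne,
      fun v ⟨i, hi, hr⟩ => hT.bound i (hk.trans hi) _ _ hr⟩
  · have hk' : k < N := not_le.1 hk
    induction hd : N - k using Nat.strong_induction_on generalizing k x with
    | _ d ih =>
      -- A hereditary root of the lowest `(k+1)`-sheet is one of the whole `k`-sheet, by uniformity.
      obtain ⟨r, hxr, hr⟩ := hT.root k x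
      obtain ⟨w, hrw, hw, hw'⟩ : ∃ w, SameSheet R (k + 1) r w ∧
          (∀ v, SameSheet R (k + 1) r v → v ≠ w → RS R (k + 1) w v) ∧
          ∀ v, ¬ RS R (k + 1) v w := by
        by_cases hk1 : N ≤ k + 1
        · exact ⟨r, .refl r, fun v hv hne => absurd (hT.eq_of_sameSheet hk1 hv).symm hne,
            fun v ⟨i, hi, hr⟩ => hT.bound i (hk1.trans hi) _ _ hr⟩
        · exact ih (N - (k + 1)) (by omega) (k + 1) r hk1 (not_le.1 hk1) rfl
      have hkw : SameSheet R k x w := hxr.trans (hrw.mono k.le_succ)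
      refine ⟨w, hkw, fun v hv hne => ?_, fun v hv => ?_⟩
      · rcases hr v hv with h | h
        · exact (hw v h hne).mono k.le_succ
        · exact ⟨k, le_rfl, hT.uniform k _ _ _ _ hrw (.refl v) h⟩
      · rcases hv.cases with h | h
        · rcases hr v (hkw.trans (SameSheet.of_rel h).symm) with h' | h'
          · exact hT.irrefl k w (hT.uniform k _ _ _ _ (h'.symm.trans hrw) (.refl w) h)
          · exact hT.irrefl k w (hT.uniform k _ _ _ _ hrw (.refl w) (hT.trans k _ _ _ h' h))
        · exact hw' v h

end IsSheetTree

/-! ### Morphisms at a single level. -/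

/-- The conditions on a morphism that concern the relation `R m` and the topology `τ`, for
targets `w` in `A`. -/
structure IsLevelMorphism {X : Type u} (R : ℕ → T → T → Prop) (m : ℕ) (A : Set T)
    (τ : TopologicalSpace X) (f : X → T) : Prop where
  isOpenMap : ∀ U, IsOpen[τ] U → ∀ x ∈ U, ∀ t, R m (f x) t → ∃ y ∈ U, f y = t
  isOpen_preimage : ∀ w ∈ A, (∀ v, ¬ RS R (m + 1) v w) →
    IsOpen[τ] (f ⁻¹' {v | RS R m w v}) ∧ IsOpen[τ] (f ⁻¹' ({v | RS R m w v} ∪ {w}))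
  discrete : ∀ w ∈ A, (∀ v, ¬ RS R (m + 1) v w) → ∀ x, f x = w →
    ∃ U, IsOpen[τ] U ∧ x ∈ U ∧ ∀ y ∈ U, f y = w → y = x

namespace IsLevelMorphism

variable {X Y Z O₁ O₂ : Type u} {m : ℕ} {A A₁ A₂ : Set T}

lemma comp {τ : TopologicalSpace X} {σ : TopologicalSpace Y} {g : Y → T} {r : X → Y}
    (hg : IsLevelMorphism R m A σ g) (hr : IsDMap τ σ r) : IsLevelMorphism R m A τ (g ∘ r) := by
  obtain ⟨h1, h2, h3⟩ := isDMap_iff.1 hr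
  refine ⟨fun U hU x hx t ht => ?_, fun w hw hroot => ?_, fun w hw hroot x hx => ?_⟩
  · obtain ⟨_, ⟨y, hy, rfl⟩, e⟩ := hg.isOpenMap _ (h2 U hU) (r x) ⟨x, hx, rfl⟩ t ht
    exact ⟨y, hy, e⟩
  · obtain ⟨ha, hb⟩ := hg.isOpen_preimage w hw hroot
    exact ⟨h1 _ ha, h1 _ hb⟩
  · obtain ⟨V, hV, hxV, hVi⟩ := hg.discrete w hw hroot (r x) hx
    obtain ⟨U, hU, hxU, hinj⟩ := h3 x
    exact ⟨U ∩ r ⁻¹' V, hU.inter (h1 V hV), ⟨hxU, hxV⟩,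
      fun y hy e => hinj y hy.1 (hVi _ hy.2 e)⟩

lemma preimage_of_subset {f : Z → T} {i₁ : O₁ → Z} {i₂ : O₂ → Z}
    (hcov : ∀ z, z ∈ Set.range i₁ ∨ z ∈ Set.range i₂) (h₂ : ∀ o, f (i₂ o) ∉ A₁) {S : Set T}
    (hS : S ⊆ A₁) : f ⁻¹' S = i₁ '' ((f ∘ i₁) ⁻¹' S) := by
  ext z
  constructor
  · intro hz
    rcases hcov z with ⟨o, rfl⟩ | ⟨o, rfl⟩
    · exact ⟨o, hz, rfl⟩
    · exact absurd (hS hz) (h₂ o)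
  · rintro ⟨o, ho, rfl⟩
    exact ho

/-- The conditions at a target lying in the image of an open piece only depend on that piece. -/
lemma piece {τ : TopologicalSpace Z} {f : Z → T} {i₁ : O₁ → Z} {i₂ : O₂ → Z}
    (hi₁ : IsOpenInj τ i₁) (hcov : ∀ z, z ∈ Set.range i₁ ∨ z ∈ Set.range i₂)
    (h₁ : IsLevelMorphism R m A₁ (TopologicalSpace.induced i₁ τ) (f ∘ i₁))
    (hf₂ : ∀ o, f (i₂ o) ∉ A₁) (hA₁ : ∀ w ∈ A₁, ∀ v, RS R m w v → v ∈ A₁) {w : T} (hw : w ∈ A₁)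
    (hroot : ∀ v, ¬ RS R (m + 1) v w) :
    (IsOpen[τ] (f ⁻¹' {v | RS R m w v}) ∧ IsOpen[τ] (f ⁻¹' ({v | RS R m w v} ∪ {w}))) ∧
      ∀ x, f x = w → ∃ U, IsOpen[τ] U ∧ x ∈ U ∧ ∀ y ∈ U, f y = w → y = x := by
  obtain ⟨ha, hb⟩ := h₁.isOpen_preimage w hw hroot
  refine ⟨⟨?_, ?_⟩, fun x hx => ?_⟩
  · rw [preimage_of_subset (S := {v | RS R m w v}) hcov hf₂ (hA₁ w hw)]
    exact hi₁.isOpen_induced.1 ha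
  · rw [preimage_of_subset (S := {v | RS R m w v} ∪ {w}) hcov hf₂
      (Set.union_subset (hA₁ w hw) (Set.singleton_subset_iff.2 hw))]
    exact hi₁.isOpen_induced.1 hb
  · rcases hcov x with ⟨o, rfl⟩ | ⟨o, rfl⟩
    · obtain ⟨U, hU, ho, hinj⟩ := h₁.discrete w hw hroot o hx
      refine ⟨i₁ '' U, hi₁.isOpen_induced.1 hU, ⟨o, ho, rfl⟩, ?_⟩
      rintro _ ⟨p, hp, rfl⟩ e
      rw [hinj p hp e]
    · exact absurd (hx ▸ hw) (hf₂ o)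

lemma isOpenMap_piece {τ : TopologicalSpace Z} {f : Z → T} {i₁ : O₁ → Z}
    (h₁ : IsLevelMorphism R m A₁ (TopologicalSpace.induced i₁ τ) (f ∘ i₁)) {U : Set Z}
    (hU : IsOpen[τ] U) {o : O₁} (ho : i₁ o ∈ U) {t : T} (ht : R m (f (i₁ o)) t) :
    ∃ y ∈ U, f y = t := by
  obtain ⟨y, hy, e⟩ := h₁.isOpenMap (i₁ ⁻¹' U) (isOpen_induced_preimage hU) o ho t ht
  exact ⟨i₁ y, hy, e⟩

lemma glue {τ : TopologicalSpace Z} {f : Z → T} {i₁ : O₁ → Z} {i₂ : O₂ → Z}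
    (hi₁ : IsOpenInj τ i₁) (hi₂ : IsOpenInj τ i₂)
    (hcov : ∀ z, z ∈ Set.range i₁ ∨ z ∈ Set.range i₂)
    (h₁ : IsLevelMorphism R m A₁ (TopologicalSpace.induced i₁ τ) (f ∘ i₁))
    (h₂ : IsLevelMorphism R m A₂ (TopologicalSpace.induced i₂ τ) (f ∘ i₂))
    (hf₁ : ∀ o, f (i₁ o) ∈ A₁) (hf₂ : ∀ o, f (i₂ o) ∈ A₂) (hd : Disjoint A₁ A₂)
    (hA₁ : ∀ w ∈ A₁, ∀ v, RS R m w v → v ∈ A₁) (hA₂ : ∀ w ∈ A₂, ∀ v, RS R m w v → v ∈ A₂) :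
    IsLevelMorphism R m (A₁ ∪ A₂) τ f := by
  have p₁ : ∀ w ∈ A₁, _ := fun w hw hroot => piece hi₁ hcov h₁
    (fun o => Set.disjoint_right.1 hd (hf₂ o)) hA₁ (w := w) hw hroot
  have p₂ : ∀ w ∈ A₂, _ := fun w hw hroot => piece hi₂ (fun z => (hcov z).symm) h₂
    (fun o => Set.disjoint_left.1 hd (hf₁ o)) hA₂ (w := w) hw hroot
  refine ⟨fun U hU x hx t ht => ?_, fun w hw hroot => ?_, fun w hw hroot => ?_⟩
  · rcases hcov x with ⟨o, rfl⟩ | ⟨o, rfl⟩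
    · exact isOpenMap_piece h₁ hU hx ht
    · exact isOpenMap_piece h₂ hU hx ht
  · exact hw.elim (fun h => (p₁ w h hroot).1) fun h => (p₂ w h hroot).1
  · exact hw.elim (fun h => (p₁ w h hroot).2) fun h => (p₂ w h hroot).2

end IsLevelMorphism

/-! ### Realisation of sheets by induction. -/

/-- The points of `A` are the values of a morphism, with respect to the relations `R j`, `k ≤ j`,
from an ordinal lme-space `[1, lam]` with `lam < ε₀`; a root of `A` is only taken at `lam`. -/
def Realizes (R : ℕ → T → T → Prop) (k : ℕ) (A : Set T) : Prop :=
  ∃ lam : Ordinal.{u}, lam < ε₀ ∧ ∃ (τ : ℕ → TopologicalSpace (Set.Icc 1 lam))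
    (f : Set.Icc 1 lam → T), IsLMESeq (Preorder.topology _) τ ∧
    (∀ j, IsLevelMorphism R (k + j) A (τ j) f) ∧ Set.range f = A ∧
    ∀ w ∈ A, (∀ v ∈ A, v ≠ w → RS R k w v) → (∀ v ∈ A, ¬ RS R k v w) → ∀ x, f x = w → x.1 = lam

lemma realizes_empty (k : ℕ) : Realizes.{u} R k ∅ := by
  have : IsEmpty (Set.Icc 1 (0 : Ordinal.{u})) :=
    ⟨fun x => absurd (x.2.1.trans x.2.2) (by simp)⟩
  refine ⟨0, Ordinal.epsilon_pos 0, fun _ => Preorder.topology _, isEmptyElim,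
    .of_subsingleton _ _, fun j => ⟨fun U _ x => isEmptyElim x, fun w hw => hw.elim,
      fun w hw => hw.elim⟩, Set.range_eq_empty _, fun w hw => hw.elim⟩

lemma realizes_singleton {N : ℕ} (hT : IsSheetTree R N) {k : ℕ} (hk : N ≤ k) (a : T) :
    Realizes.{u} R k {a} := by
  have hs : Subsingleton (Set.Icc 1 (1 : Ordinal.{u})) := by
    rw [Set.Icc_self]
    infer_instance
  have hR : ∀ j w v, ¬ RS R (k + j) w v := fun j w v ⟨i, hi, hr⟩ => hT.bound i (by omega) _ _ hr
  refine ⟨1, by simpa using Ordinal.natCast_lt_epsilon 1 0, fun _ => Preorder.topology _,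
    fun _ => a, .of_subsingleton _ _, fun j => ⟨?_, ?_, ?_⟩, ?_, ?_⟩
  · exact fun U _ x _ t ht => absurd ⟨_, le_rfl, ht⟩ (hR j a t)
  · rintro w rfl -
    have : {v | RS R (k + j) w v} = ∅ := Set.eq_empty_of_forall_notMem fun v => hR j w v
    rw [this]
    refine ⟨by simp, ?_⟩
    have h2 : (fun _ : Set.Icc 1 (1 : Ordinal.{u}) => w) ⁻¹' (∅ ∪ {w}) = Set.univ := by
      ext; simp
    rw [h2]
    exact @isOpen_univ _ (Preorder.topology _)
  · exact fun w _ _ x _ => ⟨Set.univ, @isOpen_univ _ (Preorder.topology _), trivial,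
      fun y _ _ => Subsingleton.elim _ _⟩
  · have : Nonempty (Set.Icc 1 (1 : Ordinal.{u})) := ⟨⟨1, le_rfl, le_rfl⟩⟩
    exact Set.range_const
  · exact fun _ _ _ _ x _ => le_antisymm x.2.2 x.2.1

/-- The two intervals are open summands of `[1, l₁ + l₂]`, and the identity maps lift both sequences
at once. The root condition is vacuous, since no point lies below both parts. -/
lemma Realizes.union {k : ℕ} {A₁ A₂ : Set T} (h₁ : Realizes.{u} R k A₁) (h₂ : Realizes.{u} R k A₂)
    (hne₁ : A₁.Nonempty) (hne₂ : A₂.Nonempty) (hd : Disjoint A₁ A₂)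
    (hA₁ : ∀ w ∈ A₁, ∀ v, RS R k w v → v ∈ A₁) (hA₂ : ∀ w ∈ A₂, ∀ v, RS R k w v → v ∈ A₂) :
    Realizes.{u} R k (A₁ ∪ A₂) := by
  obtain ⟨l₁, hl₁, υ₁, f₁, hυ₁, hf₁, hr₁, -⟩ := h₁
  obtain ⟨l₂, hl₂, υ₂, f₂, hυ₂, hf₂, hr₂, -⟩ := h₂
  let i₁ : Set.Icc 1 l₁ → Set.Icc 1 (l₁ + l₂) := shift (a := 0) (by rw [zero_add]; exact le_self_add)
  let i₂ : Set.Icc 1 l₂ → Set.Icc 1 (l₁ + l₂) := shift (a := l₁) le_rfl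
  have hi₁ : IsOpenInj (Preorder.topology _) i₁ := isOpenInj_shift _
  have hi₂ : IsOpenInj (Preorder.topology _) i₂ := isOpenInj_shift _
  have hdis : Disjoint (Set.range i₁) (Set.range i₂) := by
    rw [range_shift, range_shift, Set.disjoint_left]
    rintro x ⟨-, hx⟩ ⟨hx', -⟩
    rw [zero_add] at hx
    exact hx'.not_ge hx
  have hcov : ∀ z, z ∈ Set.range i₁ ∨ z ∈ Set.range i₂ := by
    intro z
    rw [range_shift, range_shift]
    rcases le_or_gt z.1 l₁ with h | h
    · exact Or.inl ⟨zero_lt_one.trans_le z.2.1, by rwa [zero_add]⟩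
    · exact Or.inr ⟨h, z.2.2⟩
  have hid : ∀ (l : Ordinal.{u}) (σ : TopologicalSpace (Set.Icc 1 l)), IsDMap σ σ id :=
    fun l σ => isDMap_iff.2 ⟨fun _ hV => hV, fun _ hU => by rwa [Set.image_id],
      fun _ => ⟨Set.univ, isOpen_univ, trivial, fun _ _ e => e⟩⟩
  obtain ⟨σ, hσ, d₁, d₂⟩ := exists_isLMESeq_lift (isScattered_Icc (l₁ + l₂)) hi₁ hi₂ hdis
    (r₁ := id) (r₂ := id) (by rw [induced_shift]; exact hid _ _)
    (by rw [induced_shift]; exact hid _ _) hυ₁ hυ₂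
  have hex : ∀ z, ∃ t, (∀ o, i₁ o = z → f₁ o = t) ∧ ∀ o, i₂ o = z → f₂ o = t := by
    intro z
    rcases hcov z with ⟨o, rfl⟩ | ⟨o, rfl⟩
    · exact ⟨f₁ o, fun p e => by rw [hi₁.inj e],
        fun p e => absurd ⟨p, e⟩ (Set.disjoint_left.1 hdis ⟨o, rfl⟩)⟩
    · exact ⟨f₂ o, fun p e => absurd ⟨o, rfl⟩ (Set.disjoint_left.1 hdis ⟨p, e⟩),
        fun p e => by rw [hi₂.inj e]⟩
  choose f hfa hfb using hex
  have e₁ : ∀ o, f (i₁ o) = f₁ o := fun o => (hfa _ o rfl).symm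
  have e₂ : ∀ o, f (i₂ o) = f₂ o := fun o => (hfb _ o rfl).symm
  refine ⟨l₁ + l₂, add_lt_epsilon_zero hl₁ hl₂, σ, f, hσ, fun j => ?_, ?_, ?_⟩
  · refine IsLevelMorphism.glue (hi₁.mono (hσ.le_base j)) (hi₂.mono (hσ.le_base j)) hcov ?_ ?_
      ?_ ?_ hd (fun w hw v hv => hA₁ w hw v (hv.mono (by omega)))
      (fun w hw v hv => hA₂ w hw v (hv.mono (by omega)))
    · rw [show f ∘ i₁ = f₁ ∘ id from funext e₁]
      exact (hf₁ j).comp (d₁ j)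
    · rw [show f ∘ i₂ = f₂ ∘ id from funext e₂]
      exact (hf₂ j).comp (d₂ j)
    · exact fun o => by rw [e₁, ← hr₁]; exact ⟨o, rfl⟩
    · exact fun o => by rw [e₂, ← hr₂]; exact ⟨o, rfl⟩
  · rw [← hr₁, ← hr₂]
    ext t
    constructor
    · rintro ⟨z, rfl⟩
      rcases hcov z with ⟨o, rfl⟩ | ⟨o, rfl⟩
      · exact Or.inl ⟨o, (e₁ o).symm⟩
      · exact Or.inr ⟨o, (e₂ o).symm⟩
    · rintro (⟨o, rfl⟩ | ⟨o, rfl⟩)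
      · exact ⟨_, e₁ o⟩
      · exact ⟨_, e₂ o⟩
  · intro w hw hroot _ x _
    exfalso
    obtain ⟨v₁, hv₁⟩ := hne₁
    obtain ⟨v₂, hv₂⟩ := hne₂
    rcases hw with hw | hw
    · have hne : v₂ ≠ w := fun e => Set.disjoint_left.1 hd hw (e ▸ hv₂)
      exact Set.disjoint_left.1 hd (hA₁ w hw _ (hroot v₂ (Or.inr hv₂) hne)) hv₂
    · have hne : v₁ ≠ w := fun e => Set.disjoint_left.1 hd hv₁ (e ▸ hw)
      exact Set.disjoint_left.1 hd hv₁ (hA₂ w hw _ (hroot v₁ (Or.inl hv₁) hne))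

/-- On levels above `k` the two pieces are open and are glued. At level `k`, openness at points of
`C` is the density of the copies of `[1, μ]`, and the conditions at the root hold because it is
taken only at the top point. -/
lemma Realizes.cone {N : ℕ} (hT : IsSheetTree R N) {k : ℕ} (a : T)
    (h₁ : Realizes.{u} R k {v | R k a v})
    (h₂ : Realizes.{u} R (k + 1) {v | SameSheet R (k + 1) a v}) :
    Realizes.{u} R k ({v | R k a v} ∪ {v | SameSheet R (k + 1) a v}) := by
  classical
  obtain ⟨μ, hμ, υ, g₁, hυ, hg₁, hr₁, -⟩ := h₁
  obtain ⟨κ, hκ, θ, g₂, hθ, hg₂, hr₂, hroot₂⟩ := h₂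
  obtain ⟨w₀, haw, hw₀, hw₀'⟩ := hT.exists_root (k + 1) a
  have hg₁A : ∀ y, R k a (g₁ y) := fun y => hr₁.subset ⟨y, rfl⟩
  have hg₂A : ∀ y, SameSheet R (k + 1) a (g₂ y) := fun y => hr₂.subset ⟨y, rfl⟩
  obtain ⟨x₀, hx₀⟩ : w₀ ∈ Set.range g₂ := hr₂.superset haw
  have hx₀κ : ∀ x, g₂ x = w₀ → x.1 = κ := hroot₂ w₀ haw hw₀ fun v _ => hw₀' v
  obtain ⟨lam, hlam, C, c, r, τ, hτ, hi₁, hc, hi₂, hr, hrs, hdense, t, htlam, htκ, htu⟩ :=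
    exists_cone_lmeSeq hμ hκ (x₀.2.1.trans x₀.2.2) hυ hθ
  let f : Set.Icc 1 lam → T := fun x => if hx : x ∈ C then g₂ (r ⟨x, hx⟩) else g₁ (c ⟨x, hx⟩)
  have fC : ∀ x : ↥C, f x.1 = g₂ (r x) := fun x => dif_pos x.2
  have fO : ∀ x : ↥Cᶜ, f x.1 = g₁ (c x) := fun x => dif_neg x.2
  have hcov : ∀ z, z ∈ Set.range (Subtype.val : ↥Cᶜ → Set.Icc 1 lam) ∨
      z ∈ Set.range (Subtype.val : ↥C → Set.Icc 1 lam) := by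
    intro z
    rw [Subtype.range_coe, Subtype.range_coe]
    exact (em (z ∈ C)).symm
  have hdis : Disjoint {v | R k a v} {v | SameSheet R (k + 1) a v} :=
    Set.disjoint_left.2 fun v h h' => hT.irrefl k a (hT.uniform k _ _ _ _ (.refl a) h'.symm h)
  have hup : ∀ m, k ≤ m → ∀ w ∈ {v | R k a v}, ∀ v, RS R m w v → v ∈ {v | R k a v} := by
    intro m hm w hw v hv
    rcases (hv.mono hm).cases with h | h
    · exact hT.trans k _ _ _ hw h
    · exact hT.uniform k _ _ _ _ (.refl a) (.of_RS h) hw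
  -- Both facts compose: `g₂` takes `w₀` only at `κ`, and `r` takes `κ` only at `t`. This also
  -- renews the root invariant.
  have htop : ∀ x, f x = w₀ ↔ x = t.1 := by
    intro x
    constructor
    · intro hx
      by_cases hxC : x ∈ C
      · have := fC ⟨x, hxC⟩
        exact congrArg Subtype.val (htu ⟨x, hxC⟩ (hx₀κ _ (this.symm.trans hx)))
      · have := fO ⟨x, hxC⟩
        exact absurd haw (Set.disjoint_left.1 hdis (hx ▸ this ▸ hg₁A _))
    · rintro rfl
      rw [fC t, ← hx₀]
      exact congrArg g₂ (Subtype.ext (htκ.trans (hx₀κ x₀ hx₀).symm))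
  have hrange : Set.range f = {v | R k a v} ∪ {v | SameSheet R (k + 1) a v} := by
    rw [← hr₁, ← hr₂]
    ext v
    constructor
    · rintro ⟨x, rfl⟩
      rcases hcov x with ⟨o, rfl⟩ | ⟨o, rfl⟩
      · exact Or.inl ⟨_, (fO o).symm⟩
      · exact Or.inr ⟨_, (fC o).symm⟩
    · rintro (⟨y, rfl⟩ | ⟨y, rfl⟩)
      · obtain ⟨o, -, rfl⟩ := hdense t.1 t.2 Set.univ (@isOpen_univ _ (τ 0)) trivial y
        exact ⟨_, fO o⟩
      · obtain ⟨o, rfl⟩ := hrs y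
        exact ⟨_, fC o⟩
  have hlev₁ : ∀ j, IsLevelMorphism R (k + j) {v | R k a v}
      (TopologicalSpace.induced Subtype.val (τ j)) (f ∘ (Subtype.val : ↥Cᶜ → _)) := by
    intro j
    rw [show f ∘ (Subtype.val : ↥Cᶜ → _) = g₁ ∘ c from funext fO]
    exact (hg₁ j).comp (hc j)
  have hrootA : ∀ w ∈ {v | R k a v} ∪ {v | SameSheet R (k + 1) a v},
      (∀ v, SameSheet R (k + 1) a v → ¬ RS R (k + 1) v w) → w ∉ {v | R k a v} → w = w₀ := by
    intro w hw hroot hw'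
    by_contra hne
    exact hroot w₀ haw (hw₀ w (hw.resolve_left hw') hne)
  refine ⟨lam, hlam, τ, f, hτ, fun j => ?_, hrange, ?_⟩
  · cases j with
    | zero =>
      have hp : ∀ w ∈ {v | R k a v}, _ := fun w hw hroot =>
        IsLevelMorphism.piece (hi₁ 0) hcov (hlev₁ 0)
          (fun o => by rw [fC]; exact Set.disjoint_right.1 hdis (hg₂A _)) (hup _ le_rfl)
          (w := w) hw hroot
      refine ⟨fun U hU x hx s hs => ?_, fun w hw hroot => ?_, fun w hw hroot x hx => ?_⟩
      · rcases hcov x with ⟨o, rfl⟩ | ⟨o, rfl⟩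
        · exact (hlev₁ 0).isOpenMap_piece hU hx hs
        · have hs' : s ∈ Set.range g₁ := by
            rw [hr₁]
            rw [fC] at hs
            exact hT.uniform k _ _ _ _ (hg₂A _).symm (.refl s) hs
          obtain ⟨y, rfl⟩ := hs'
          obtain ⟨p, hp, rfl⟩ := hdense o.1 o.2 U hU hx y
          exact ⟨p.1, hp, fO p⟩
      · by_cases hw' : w ∈ {v | R k a v}
        · exact (hp w hw' hroot).1
        · obtain rfl := hrootA w hw (fun v _ => hroot v) hw'
          have hRS : ∀ x, RS R k w (f x) ↔ f x ≠ w := by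
            intro x
            constructor
            · intro h e
              rw [e] at h
              rcases h.cases with h | h
              · exact hT.irrefl k w h
              · exact hw₀' w h
            · intro hne
              rcases hrange.subset ⟨x, rfl⟩ with h | h
              · exact ⟨k, le_rfl, hT.uniform k _ _ _ _ haw (.refl _) h⟩
              · exact (hw₀ _ h hne).mono k.le_succ
          -- The preimage of the points above the root is the initial segment `[1, lam)`, open
          -- already in the order topology.
          have e1 : f ⁻¹' {v | RS R (k + 0) w v} = {x | x ≠ t.1} := by
            ext x
            exact (hRS x).trans (not_congr (htop x))
          have e2 : f ⁻¹' ({v | RS R (k + 0) w v} ∪ {w}) = Set.univ := by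
            ext x
            simp only [Set.mem_preimage, Set.mem_univ, iff_true]
            exact (em (f x = w)).symm.imp (hRS x).2 id
          rw [e1, e2]
          refine ⟨hτ.le_base 0 _ (isOpen_of_local fun x hx => ?_), @isOpen_univ _ (τ 0)⟩
          refine ⟨_, isOpen_Ioc_Icc 0 x.1, ⟨zero_lt_one.trans_le x.2.1, le_rfl⟩, ?_⟩
          rintro y ⟨-, hy⟩ rfl
          exact hx (Subtype.ext (le_antisymm (x.2.2.trans htlam.ge) hy))
      · by_cases hw' : w ∈ {v | R k a v}
        · exact (hp w hw' hroot).2 x hx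
        · obtain rfl := hrootA w hw (fun v _ => hroot v) hw'
          exact ⟨Set.univ, @isOpen_univ _ (τ 0), trivial,
            fun y _ hy => ((htop y).1 hy).trans ((htop x).1 hx).symm⟩
    | succ j =>
      refine IsLevelMorphism.glue (hi₁ (j + 1)) (hi₂ j) hcov (hlev₁ (j + 1)) ?_
        (fun o => by rw [fO]; exact hg₁A _) (fun o => by rw [fC]; exact hg₂A _) hdis
        (hup _ (by omega)) (fun w hw v hv => ?_)
      · rw [show f ∘ (Subtype.val : ↥C → _) = g₂ ∘ r from funext fC,
          show k + (j + 1) = k + 1 + j by omega]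
        exact (hg₂ j).comp (hr j)
      · exact SameSheet.trans hw (.of_RS (hv.mono (by omega)))
  · intro w hw hroot hroot' x hx
    have hne : w = w₀ := by
      by_contra hne
      exact hroot' w₀ (Or.inr haw) (by
        rcases hw with h | h
        · exact ⟨k, le_rfl, hT.uniform k _ _ _ _ haw (.refl _) h⟩
        · exact (hw₀ _ h hne).mono k.le_succ)
    rw [(htop x).1 (hx.trans hne), htlam]

variable [Finite T]

/-- Induction on the size of `A`, through an `R k`-minimal point `a` and the cone `B` over its
sheet. If `B` exhausts `A`, the strict successors form a smaller set and `Realizes.cone` applies.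
Otherwise tree linearity and minimality of `a` make `A \ B` upward closed, and `Realizes.union`
applies. -/
lemma realizes_of_sheets {N : ℕ} (hT : IsSheetTree R N) {k : ℕ}
    (hQ : ∀ a, Realizes.{u} R (k + 1) {v | SameSheet R (k + 1) a v}) (A : Set T)
    (hup : ∀ w ∈ A, ∀ v, R k w v → v ∈ A)
    (hsh : ∀ w ∈ A, ∀ v, SameSheet R (k + 1) w v → v ∈ A) : Realizes.{u} R k A := by
  have hRS : ∀ A : Set T, (∀ w ∈ A, ∀ v, R k w v → v ∈ A) →
      (∀ w ∈ A, ∀ v, SameSheet R (k + 1) w v → v ∈ A) → ∀ w ∈ A, ∀ v, RS R k w v → v ∈ A :=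
    fun A h1 h2 w hw v hv => hv.cases.elim (h1 w hw v) fun h => h2 w hw v (.of_RS h)
  induction hn : A.ncard using Nat.strong_induction_on generalizing A with
  | _ n ih =>
    subst hn
    rcases A.eq_empty_or_nonempty with rfl | hne
    · exact realizes_empty k
    have hwf : WellFounded (R k) := by
      have : Std.Irrefl (R k) := ⟨hT.irrefl k⟩
      have : IsTrans T (R k) := ⟨hT.trans k⟩
      exact Finite.wellFounded_of_trans_of_irrefl (R k)
    obtain ⟨a, ha, hmin⟩ := hwf.has_min A hne
    let B : Set T := {v | R k a v} ∪ {v | SameSheet R (k + 1) a v}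
    have hBA : B ⊆ A := by
      rintro v (h | h)
      · exact hup a ha v h
      · exact hsh a ha v h
    have haB : a ∈ B := Or.inr (.refl a)
    have hup₁ : ∀ w ∈ {v | R k a v}, ∀ v, R k w v → v ∈ {v | R k a v} :=
      fun w hw v hv => hT.trans k _ _ _ hw hv
    have hsh₁ : ∀ w ∈ {v | R k a v}, ∀ v, SameSheet R (k + 1) w v → v ∈ {v | R k a v} :=
      fun w hw v hv => hT.uniform k _ _ _ _ (.refl a) hv hw
    have hupB : ∀ w ∈ B, ∀ v, R k w v → v ∈ B := by
      rintro w (h | h) v hv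
      · exact Or.inl (hup₁ w h v hv)
      · exact Or.inl (hT.uniform k _ _ _ _ (SameSheet.symm h) (.refl v) hv)
    have hshB : ∀ w ∈ B, ∀ v, SameSheet R (k + 1) w v → v ∈ B := by
      rintro w (h | h) v hv
      · exact Or.inl (hsh₁ w h v hv)
      · exact Or.inr (SameSheet.trans h hv)
    by_cases hAB : A ⊆ B
    · rw [← hBA.antisymm hAB]
      refine Realizes.cone hT a (ih _ ?_ _ hup₁ hsh₁ rfl) (hQ a)
      refine Set.ncard_lt_ncard ⟨fun v hv => hBA (Or.inl hv), fun h => ?_⟩ A.toFinite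
      exact hT.irrefl k a (h ha)
    · have hupD : ∀ w ∈ A \ B, ∀ v, R k w v → v ∈ A \ B := by
        rintro w ⟨hwA, hwB⟩ v hv
        refine ⟨hup w hwA v hv, ?_⟩
        rintro (h | h)
        · rcases hT.linear k _ _ _ h hv with h' | h' | h'
          · exact hwB (Or.inl h')
          · exact hwB (Or.inr h')
          · exact hmin w hwA h'
        · exact hmin w hwA (hT.uniform k _ _ _ _ (.refl w) (SameSheet.symm h) hv)
      have hshD : ∀ w ∈ A \ B, ∀ v, SameSheet R (k + 1) w v → v ∈ A \ B :=
        fun w hw v hv => ⟨hsh w hw.1 v hv, fun h => hw.2 (hshB v h w hv.symm)⟩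
      have hneD : (A \ B).Nonempty := Set.sdiff_nonempty.2 hAB
      rw [← Set.union_sdiff_cancel hBA]
      refine Realizes.union (ih _ ?_ B hupB hshB rfl) (ih _ ?_ (A \ B) hupD hshD rfl) ⟨a, haB⟩ hneD
        Set.disjoint_sdiff_right (hRS B hupB hshB) (hRS _ hupD hshD)
      · exact Set.ncard_lt_ncard ⟨hBA, hAB⟩ A.toFinite
      · exact Set.ncard_lt_ncard ⟨Set.sdiff_subset, fun h => (h ha).2 haB⟩ A.toFinite

lemma realizes_sheet {N : ℕ} (hT : IsSheetTree R N) (k : ℕ) (a : T) :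
    Realizes.{u} R k {v | SameSheet R k a v} := by
  by_cases hk : N ≤ k
  · have : {v | SameSheet R k a v} = {a} := by
      ext v
      exact ⟨fun h => (hT.eq_of_sameSheet hk h).symm, fun h => by
        rw [Set.mem_singleton_iff.1 h]; exact .refl a⟩
    rw [this]
    exact realizes_singleton hT hk a
  · exact realizes_of_sheets hT (fun b => realizes_sheet hT (k + 1) b) _
      (fun w hw v hv => SameSheet.trans hw (.of_rel hv))
      (fun w hw v hv => SameSheet.trans hw (hv.mono k.le_succ))
termination_by N - k

theorem realizes_univ {N : ℕ} (hT : IsSheetTree R N) : Realizes.{u} R 0 Set.univ :=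
  realizes_of_sheets hT (realizes_sheet hT 1) _ (fun _ _ _ _ => trivial) fun _ _ _ _ => trivial

end Realization

/-! ### From sheet-wise realisations to ordinal lme-spaces and J-morphisms. -/

section Assembly

variable {T : Type v} {n : ℕ}

/-- A finite family of relations, extended by empty relations. -/
def extendRel (R : Fin (n + 1) → T → T → Prop) (k : ℕ) (x y : T) : Prop :=
  ∃ h : k < n + 1, R ⟨k, h⟩ x y

lemma RS_extendRel (R : Fin (n + 1) → T → T → Prop) (k : ℕ) : RS (extendRel R) k = RStar R k := by
  funext x y
  refine propext ⟨?_, ?_⟩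
  · rintro ⟨i, hi, h, hr⟩
    exact ⟨⟨i, h⟩, hi, hr⟩
  · rintro ⟨i, hi, hr⟩
    exact ⟨i, hi, i.2, hr⟩

/-- Uniformity lets a relation between sheets be read off at any representatives, so the tree axioms
for sets of points become pointwise. -/
lemma IsJTree.isSheetTree {R : Fin (n + 1) → T → T → Prop} (hT : IsJTree R) :
    IsSheetTree (extendRel R) (n + 1) := by
  have hsheet : ∀ k x, IsSheet R k {y | SameSheet (extendRel R) k x y} := fun k x =>
    ⟨x, by rw [SameSheet, RS_extendRel]⟩
  have hroot : ∀ (k : ℕ) (hk : k < n + 1) (x : T), ∃ r, SameSheet (extendRel R) k x r ∧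
      ∀ y, SameSheet (extendRel R) k x y →
        SameSheet (extendRel R) (k + 1) r y ∨ extendRel R k r y := by
    intro k hk x
    obtain ⟨P, ⟨⟨r, rfl⟩, hPS⟩, hP⟩ := (hT.tree ⟨k, hk⟩ _ (hsheet k x)).root
    simp only [← RS_extendRel] at hP hPS
    refine ⟨r, hPS (SameSheet.refl r), fun y hy => ?_⟩
    rcases hP {z | SameSheet (extendRel R) (k + 1) y z} ⟨hsheet (k + 1) y, fun z hz =>
      SameSheet.trans hy (SameSheet.mono k.le_succ hz)⟩ with h | h
    · exact Or.inl (h.subset (SameSheet.refl y))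
    · refine Or.inr ⟨hk, hT.uniform ⟨k, hk⟩ _ _ ?_ (hsheet (k + 1) y) h r (SameSheet.refl r) y
        (SameSheet.refl y)⟩
      exact hsheet (k + 1) r
  refine ⟨fun k hk x y h => absurd h.1 (by omega), ?_, ?_, ?_, ?_, ?_⟩
  · rintro k x ⟨hk, h⟩
    exact (hT.dually_wf ⟨k, hk⟩).irrefl.irrefl x h
  · rintro k x y z ⟨hk, h⟩ ⟨_, h'⟩
    exact ⟨hk, hT.trans _ _ _ _ h h'⟩
  · rintro k x x' y y' hx hy ⟨hk, h⟩
    exact ⟨hk, hT.uniform ⟨k, hk⟩ _ _ (hsheet (k + 1) x) (hsheet (k + 1) y)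
      ⟨x, SameSheet.refl x, y, SameSheet.refl y, h⟩ x' hx y' hy⟩
  · rintro k x y z ⟨hk, hx⟩ ⟨_, hy⟩
    have hmem : ∀ w, SameSheet (extendRel R) k z w →
        {v | SameSheet (extendRel R) (k + 1) w v} ∈
          {A | IsSheet R (k + 1) A ∧ A ⊆ {v | SameSheet (extendRel R) k z v}} :=
      fun w hw => ⟨hsheet (k + 1) w, fun v hv =>
        SameSheet.trans hw (SameSheet.mono k.le_succ hv)⟩
    have hxz : SameSheet (extendRel R) k z x :=
      SameSheet.symm (SameSheet.of_rel (R := extendRel R) ⟨hk, hx⟩)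
    have hyz : SameSheet (extendRel R) k z y :=
      SameSheet.symm (SameSheet.of_rel (R := extendRel R) ⟨hk, hy⟩)
    have huni : ∀ p q, SheetRel R ⟨k, hk⟩ {v | SameSheet (extendRel R) (k + 1) p v}
        {v | SameSheet (extendRel R) (k + 1) q v} → extendRel R k p q := fun p q h =>
      ⟨hk, hT.uniform ⟨k, hk⟩ _ _ (hsheet (k + 1) p) (hsheet (k + 1) q) h p (SameSheet.refl p) q
        (SameSheet.refl q)⟩
    rcases (hT.tree ⟨k, hk⟩ _ (hsheet k z)).linear _ (hmem x hxz) _ (hmem y hyz) _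
      (hmem z (SameSheet.refl z))
      ⟨x, SameSheet.refl x, z, SameSheet.refl z, hx⟩
      ⟨y, SameSheet.refl y, z, SameSheet.refl z, hy⟩ with h | h | h
    · exact Or.inl (huni _ _ h)
    · exact Or.inr (Or.inl (h.superset (SameSheet.refl y)))
    · exact Or.inr (Or.inr (huni _ _ h))
  · intro k x
    by_cases hk : k < n + 1
    · exact hroot k hk x
    · refine ⟨x, SameSheet.refl x, fun y hy => Or.inl ?_⟩
      have : x = y := by
        rw [SameSheet, RS_extendRel] at hy
        induction hy with
        | rel x y h =>
          obtain ⟨i, hi, -⟩ := h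
          omega
        | refl => rfl
        | symm _ _ _ ih => exact ih.symm
        | trans _ _ _ _ _ hxy hyz => exact hxy.trans hyz
      rw [this]
      exact SameSheet.refl y

lemma isHereditaryRoot_iff {R : Fin (n + 1) → T → T → Prop} {k : ℕ} {w : T} :
    IsHereditaryRoot R k w ↔ ∀ v, ¬ RS (extendRel R) k v w := by
  rw [RS_extendRel]
  exact ⟨fun h v ⟨j, hj, hr⟩ => h j hj v hr, fun h j hj v hr => h v ⟨j, hj, hr⟩⟩

lemma IsLMESeq.isLMESpace {X : Type u} {base : TopologicalSpace X} {τ : ℕ → TopologicalSpace X}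
    (h : IsLMESeq base τ) : IsLMESpace base fun k : Fin (n + 1) => τ k :=
  ⟨h.scattered_base, h.zero, fun k => h.succ k⟩

lemma IsLMESeq.isGLPSpace {X : Type u} {base : TopologicalSpace X} {τ : ℕ → TopologicalSpace X}
    (h : IsLMESeq base τ) : IsGLPSpace fun k : Fin (n + 1) => τ k :=
  ⟨fun k => h.isScattered k, fun k U hU => h.succ_le k U (nextTopology_le _ U hU),
    fun k A => h.succ_le k _ (isOpen_next_derivedSet _ A)⟩

lemma isJMorphism_of_isLevelMorphism {X : Type u} {base : TopologicalSpace X}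
    {τ : ℕ → TopologicalSpace X} (hτ : IsLMESeq base τ) {R : Fin (n + 1) → T → T → Prop}
    {f : X → T} (hf : ∀ j, IsLevelMorphism (extendRel R) (0 + j) Set.univ (τ j) f) :
    IsJMorphism (fun k : Fin (n + 1) => τ k) R f := by
  simp only [zero_add] at hf
  have hopen : ∀ k : Fin (n + 1), @IsOpenMap X T (τ k) (upsetTopology (R k)) f := by
    rintro k U hU _ ⟨x, hx, rfl⟩ t ht
    exact (hf k).isOpenMap U hU x hx t ⟨k.2, ht⟩
  have h3 : ∀ k w, IsHereditaryRoot R (k + 1) w →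
      IsOpen[τ k] (f ⁻¹' {v | RStar R k w v}) ∧
        IsOpen[τ k] (f ⁻¹' ({v | RStar R k w v} ∪ {w})) := by
    intro k w hw
    rw [← RS_extendRel]
    exact (hf k).isOpen_preimage w trivial (isHereditaryRoot_iff.1 hw)
  have h4 : ∀ k w, IsHereditaryRoot R (k + 1) w → @IsDiscrete X (τ k) (f ⁻¹' {w}) := by
    intro k w hw
    exact isDiscrete_iff_isolated.2 fun x hx =>
      (hf k).discrete w trivial (isHereditaryRoot_iff.1 hw) x hx
  -- At the last level every point is a hereditary root, so the level conditions there give discrete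
  -- fibres and open preimages of principal upsets, hence the d-map condition.
  have hlast : ∀ w, IsHereditaryRoot R (n + 1) w := fun w j hj => by omega
  refine ⟨hτ.isGLPSpace, ⟨?_, hopen _, fun w => h4 n w (hlast w)⟩, hopen,
    fun k w hw => h3 k w hw, fun k w hw => h4 k w hw⟩
  refine continuous_def.2 fun V hV => isOpen_of_local fun x hx => ?_
  refine ⟨_, (h3 n (f x) (hlast _)).2, Or.inr rfl, ?_⟩
  rintro y (⟨i, hi, hr⟩ | h)
  · have : i = Fin.last n := Fin.ext (le_antisymm (Nat.lt_succ_iff.1 i.2) hi)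
    subst this
    exact hV _ hx _ hr
  · rw [Set.mem_preimage, Set.mem_singleton_iff.1 h]
    exact hx

end Assembly

end GLPSpaces

theorem mainTheorem3 {n : ℕ} {T : Type v} [Finite T] (R : Fin (n + 1) → T → T → Prop)
    (hT : GLPSpaces.IsJTree R) :
    ∃ lam : Ordinal.{0}, lam < ε₀ ∧
      ∃ (τ : Fin (n + 1) → TopologicalSpace (Set.Icc 1 lam)) (f : Set.Icc 1 lam → T),
        GLPSpaces.IsOrdinalLMESpace lam τ ∧ GLPSpaces.IsJMorphism τ R f ∧
        Function.Surjective f := by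
  obtain ⟨lam, hlam, τ, f, hτ, hf, hr, -⟩ := GLPSpaces.realizes_univ.{0} hT.isSheetTree
  exact ⟨lam, hlam, fun k => τ k, f, hτ.isLMESpace,
    GLPSpaces.isJMorphism_of_isLevelMorphism hτ hf, Set.range_eq_univ.1 hr⟩
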